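/- Let $n\ge 0$, and let $e_1,\dots,e_n$ be the canonical generators of $\mathbb N^n$. Write $p\vee q$ for the coordinatewise maximum of $p,q\in\mathbb N^n$. All $\mathrm C^*$-algebras are unital, and homomorphisms are unital $*$-homomorphisms. A *2-cocycle* on $\mathbb N^n$ is a map $\sigma:\mathbb N^n\times\mathbb N^n\to\mathbb T$ with $\sigma(p,q)\sigma(p+q,r)=\sigma(p,q+r)\sigma(q,r)$ for all $p,q,r$. Let $L^\sigma_p$ be the isometry of $\ell^2(\mathbb N^n)$ with $L^\sigma_p\delta_q=\sigma(p,q)\delta_{p+q}$, and let $\mathcal T_r(\mathbb N^n,\sigma)\subseteq\mathcal B(\ell^2(\mathbb N^n))$ be the $\mathrm C^*$-algebra generated by $\{L^\sigma_p: p\in\mathbb N^n\}$. An *isometric $\sigma$-representation* of $\mathbb N^n$ in a $\mathrm C^*$-algebra $B$ is a map $w:\mathbb N^n\to B$ with (1) $w_p^*w_p=1$ and (2) $w_pw_q=\sigma(p,q)w_{p+q}$ for all $p,q$; it is *covariant* if, in addition, (3) $w_p^*w_q=\overline{\sigma(p,(p\vee q)-p)}\,\sigma(q,(p\vee q)-q)\,w_{(p\vee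 q)-p}\,w_{(p\vee q)-q}^*$ for all $p,q$, and *Nica covariant* if $w_pw_p^*w_qw_q^*=w_{p\vee q}w_{p\vee q}^*$ for all $p,q$. Products $\prod_{j=1}^n$ of elements of $B$ are taken in increasing order of $j$. **(A)** Let $\sigma$ be a 2-cocycle on $\mathbb N^n$. An isometric $\sigma$-representation in a $\mathrm C^*$-algebra is covariant if and only if it is Nica covariant. The relations (1)–(3) form a presentation of $\mathcal T_r(\mathbb N^n,\sigma)$: the map $p\mapsto L^\sigma_p$ is a covariant isometric $\sigma$-representation in $\mathcal T_r(\mathbb N^n,\sigma)$ whose range generates this $\mathrm C^*$-algebra, and for every covariant isometric $\sigma$-representation $w$ in a $\mathrm C^*$-algebra $B$ there is a unique homomorphism $\rho:\mathcal T_r(\mathbb N^n,\sigma)\to B$ with $\rho(L^\sigma_p)=w_p$ for all $p\in\mathbb N^n$. Moreover $\rho$ is injective if and only if $\prod_{j=1}^n(1-w_{e_j}w_{e_j}^*)\ne0$. **(B)** Let $\Theta=(\theta_{j,k})$ be an antisymmetric real $n\times n$ matrix and let $\sigma_\Theta(p,q)=e^{-\pi i\langle p,\Theta q\rangle}$, which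 is a 2-cocycle on $\mathbb N^n$. For elements $w_1,\dots,w_n$ of a $\mathrm C^*$-algebra, let $(\mathcal R_\Theta)$ be the following requirements: $$w_j^*w_j=1\ \text{ for all } j,\qquad w_jw_k=e^{-2\pi i\theta_{j,k}}w_kw_j\ \text{ for all } j,k,\qquad w_j^*w_k=e^{2\pi i\theta_{j,k}}w_kw_j^*\ \text{ for } j\neq k.$$ The elements $L^{\sigma_\Theta}_{e_1},\dots,L^{\sigma_\Theta}_{e_n}$ satisfy $(\mathcal R_\Theta)$ and generate the $\mathrm C^*$-algebra $\mathcal T_r(\mathbb N^n,\sigma_\Theta)$. Elements $w_1,\dots,w_n$ of a $\mathrm C^*$-algebra $B$ satisfy $(\mathcal R_\Theta)$ if and only if there is a unique covariant isometric $\sigma_\Theta$-representation $W$ in $B$ with $W_{e_j}=w_j$ for all $j$. If they do, there is a unique homomorphism $\rho:\mathcal T_r(\mathbb N^n,\sigma_\Theta)\to B$ with $\rho(L^{\sigma_\Theta}_{e_j})=w_j$ for all $j$; for every $p\in\mathbb N^n$ it satisfies $$\rho(L^{\sigma_\Theta}_p)=\Big(\prod_{j=1}^{n}\sigma_\Theta\big(p-\textstyle\sum_{i\le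 j}p_ie_i,\,e_j\big)^{p_j}\Big)\,w_1^{p_1}w_2^{p_2}\cdots w_n^{p_n};$$ $\rho$ is injective if and only if $\prod_{j=1}^n(1-w_jw_j^*)\neq0$; and if $w_1,\dots,w_n$ generate $B$ as a $\mathrm C^*$-algebra, then $\rho$ is an isomorphism onto $B$ if and only if $\prod_{j=1}^n(1-w_jw_j^*)\ne0$. -/

import Mathlib

open scoped Matrix

noncomputable section

namespace ToeplitzTorus

/-- Circle-valued `2`-cocycles on the additive semigroup `ℕⁿ`. -/
def IsCocycle {n : ℕ} (σ : (Fin n → ℕ) → (Fin n → ℕ) → Circle) : Prop :=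
  ∀ p q r, σ p q * σ (p + q) r = σ p (q + r) * σ q r

/-- The Hilbert space `ℓ²(ℕⁿ)`. -/
abbrev EllTwo (n : ℕ) : Type := lp (fun _ : Fin n → ℕ => ℂ) 2

/-- The standard orthonormal basis vector `δ_q` of `ℓ²(ℕⁿ)`. -/
def delta {n : ℕ} (q : Fin n → ℕ) : EllTwo n := lp.single 2 q (1 : ℂ)

theorem orthonormal_shift {n : ℕ} (σ : (Fin n → ℕ) → (Fin n → ℕ) → Circle)
    (p : Fin n → ℕ) :
    Orthonormal ℂ (fun q : Fin n → ℕ => (σ p q : ℂ) • (delta (p + q) : EllTwo n)) := by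
  rw [orthonormal_iff_ite]
  intro q r
  rw [inner_smul_left, inner_smul_right, delta, delta, lp.inner_single_left]
  by_cases h : q = r
  · subst h
    simp [Complex.conj_mul', Circle.norm_coe]
  · simp [h]

/-- The operator `L^σ_p` of the left regular `σ`-representation on `ℓ²(ℕⁿ)`: the linear isometry
with `L^σ_p δ_q = σ(p,q) δ_{p+q}` (see `leftRegular_delta`). -/
def leftRegular {n : ℕ} (σ : (Fin n → ℕ) → (Fin n → ℕ) → Circle) (p : Fin n → ℕ) :
    EllTwo n →L[ℂ] EllTwo n :=
  (orthonormal_shift σ p).orthogonalFamily.linearIsometry.toContinuousLinearMap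

theorem leftRegular_delta {n : ℕ} (σ : (Fin n → ℕ) → (Fin n → ℕ) → Circle)
    (p q : Fin n → ℕ) :
    leftRegular σ p (delta q) = (σ p q : ℂ) • delta (p + q) := by
  simp [leftRegular, delta, OrthogonalFamily.linearIsometry_apply_single]

/-- The (unital) `C*`-subalgebra of `A` generated by a set. -/
def cstarGen {A : Type*} [CStarAlgebra A] (S : Set A) : StarSubalgebra ℂ A :=
  (StarAlgebra.adjoin ℂ S).topologicalClosure

/-- The reduced twisted semigroup `C*`-algebra `𝒯_r(ℕⁿ, σ) ⊆ ℬ(ℓ²(ℕⁿ))`. -/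
def toeplitz {n : ℕ} (σ : (Fin n → ℕ) → (Fin n → ℕ) → Circle) :
    StarSubalgebra ℂ (EllTwo n →L[ℂ] EllTwo n) :=
  cstarGen (Set.range (leftRegular σ))

instance toeplitzCStarAlgebra {n : ℕ} (σ : (Fin n → ℕ) → (Fin n → ℕ) → Circle) :
    CStarAlgebra (toeplitz σ) :=
  StarSubalgebra.cstarAlgebra (toeplitz σ)
    (h_closed := StarSubalgebra.isClosed_topologicalClosure _)

/-- `L^σ_p`, as an element of `𝒯_r(ℕⁿ, σ)`. -/
def toeplitzGen {n : ℕ} (σ : (Fin n → ℕ) → (Fin n → ℕ) → Circle) (p : Fin n → ℕ) :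
    toeplitz σ :=
  ⟨leftRegular σ p, StarSubalgebra.le_topologicalClosure _
    (StarAlgebra.subset_adjoin ℂ _ (Set.mem_range_self p))⟩

/-- Isometric `σ`-representations of `ℕⁿ` in a `C*`-algebra. -/
structure IsIsometricRep {n : ℕ} (σ : (Fin n → ℕ) → (Fin n → ℕ) → Circle)
    {B : Type*} [CStarAlgebra B] (w : (Fin n → ℕ) → B) : Prop where
  isometry : ∀ p, star (w p) * w p = 1
  mul : ∀ p q, w p * w q = (σ p q : ℂ) • w (p + q)

/-- Covariance; `p ⊔ q` is the coordinatewise maximum, so no subtraction truncates. -/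
def IsCovariant {n : ℕ} (σ : (Fin n → ℕ) → (Fin n → ℕ) → Circle)
    {B : Type*} [CStarAlgebra B] (w : (Fin n → ℕ) → B) : Prop :=
  ∀ p q, star (w p) * w q =
    (star (σ p (p ⊔ q - p) : ℂ) * (σ q (p ⊔ q - q) : ℂ)) •
      (w (p ⊔ q - p) * star (w (p ⊔ q - q)))

/-- Nica covariance. -/
def IsNicaCovariant {n : ℕ} {B : Type*} [CStarAlgebra B] (w : (Fin n → ℕ) → B) : Prop :=
  ∀ p q, w p * star (w p) * (w q * star (w q)) = w (p ⊔ q) * star (w (p ⊔ q))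

/-- The generator `e_j` of `ℕⁿ`. -/
def gen {n : ℕ} (j : Fin n) : Fin n → ℕ := Pi.single j 1

/-- `∏_j (1 - w_j w_j*)`, with the factors in increasing order of `j`. -/
def defectProd {n : ℕ} {B : Type*} [CStarAlgebra B] (w : Fin n → B) : B :=
  (List.ofFn fun j => 1 - w j * star (w j)).prod

/-- `σ_Θ(p,q) = exp(-π i ⟨p, Θ q⟩)`. -/
def bichar {n : ℕ} (Θ : Matrix (Fin n) (Fin n) ℝ) (p q : Fin n → ℕ) : Circle :=
  Circle.exp (-(Real.pi * ((fun i => (p i : ℝ)) ⬝ᵥ (Θ *ᵥ fun i => (q i : ℝ)))))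

/-- `n` isometries that satisfy the relations attached to `Θ`. -/
structure IsToeplitzFamily {n : ℕ} (Θ : Matrix (Fin n) (Fin n) ℝ)
    {B : Type*} [CStarAlgebra B] (w : Fin n → B) : Prop where
  isometry : ∀ j, star (w j) * w j = 1
  comm : ∀ j k, w j * w k =
    Complex.exp (-(2 * Real.pi * Complex.I * Θ j k)) • (w k * w j)
  star_comm : ∀ j k, j ≠ k → star (w j) * w k =
    Complex.exp (2 * Real.pi * Complex.I * Θ j k) • (w k * star (w j))

/-- The element
`∏_j σ_Θ(p - p₁e₁ - ⋯ - p_j e_j, e_j)^{p_j} • (w₁^{p₁} w₂^{p₂} ⋯ w_n^{p_n})`.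
The scalar factor for `j = n` is `1`. -/
def orderedWord {n : ℕ} (Θ : Matrix (Fin n) (Fin n) ℝ) {B : Type*} [CStarAlgebra B]
    (w : Fin n → B) (p : Fin n → ℕ) : B :=
  (∏ j : Fin n, (bichar Θ (p - ∑ i ∈ Finset.Iic j, p i • gen i) (gen j) : ℂ) ^ p j) •
    (List.ofFn fun j => w j ^ p j).prod

end ToeplitzTorus

end

noncomputable section

namespace ToeplitzTorus

/-! Covariance and Nica covariance are exchanged by multiplying with `w p`, `star (w q)` and their
adjoints. The main point of (A) is that `L_p ↦ w_p` extends to a homomorphism; this is done by an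
explicit Poisson-type approximation.

For `0 ≤ l < 1` put `y = ∏ j, (1 - l² P_j)`, with `P_j` the range projection of `w (gen j)`, and
send an operator `T` to the sum of `⟨δ_r, T δ_s⟩ l^(|r|+|s|) w_r y w_s*` over a finite box. This map
is positive: for `T = S*S` the coefficients form a Gram matrix, and `y = z z*`. On `L_p L_q*` only
the entries `(p + t, q + t)` survive, their phases cancel, and the sum over `t` telescopes in each
coordinate (`sum_conj_supEval`, `poissonMap_leftRegular_eq_sum`). As `l → 1` and the box grows, the
values tend to `w_p w_q*` (`exists_approx`). Positivity bounds the norms by the values at `1`, so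
the maps converge on the closed span of the `L_p L_q*`, which is the whole Toeplitz algebra
(`submodule_toeplitz_eq_top`). The limit is multiplicative because both sides obey the same
multiplication rule for such monomials (`exists_starAlgHom`).

Injectivity rests on the defect product of the `L_{e_j}` being the rank-one projection onto `δ_0`:
compressing `a*a` by it gives a scalar multiple of it, so a nonzero kernel must contain it
(`injective_iff_defectProd_ne_zero`).

For (B), a family with the relations of `Θ` is turned into a covariant representation by its ordered
words; the phases are checked through a quadratic form (`sum_quadratic_gen_add`), and (A) applies.
-/

theorem circle_star_mul_self (z : Circle) : star (z : ℂ) * (z : ℂ) = 1 := by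
  rw [Complex.star_def, Complex.conj_mul', Circle.norm_coe]; simp

theorem circle_mul_star_self (z : Circle) : (z : ℂ) * star (z : ℂ) = 1 := by
  rw [mul_comm, circle_star_mul_self]

/-! ### Range projections and the equivalence of the two covariance conditions. -/

section Representations

variable {n : ℕ} {σ : (Fin n → ℕ) → (Fin n → ℕ) → Circle} {B : Type*} [CStarAlgebra B]
  {w : (Fin n → ℕ) → B}

/-- The range projection `w_p w_p*`. -/
def rangeProj (w : (Fin n → ℕ) → B) (p : Fin n → ℕ) : B := w p * star (w p)

theorem star_rangeProj (w : (Fin n → ℕ) → B) (p : Fin n → ℕ) :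
    star (rangeProj w p) = rangeProj w p := by simp [rangeProj]

namespace IsIsometricRep

theorem apply_zero (h : IsIsometricRep σ w) : w 0 = (σ 0 0 : ℂ) • 1 := by
  have h1 := congrArg (star (w 0) * ·) (h.mul 0 0)
  simpa [← mul_assoc, h.isometry, mul_smul_comm] using h1

theorem apply_add (h : IsIsometricRep σ w) (p q : Fin n → ℕ) :
    w (p + q) = star (σ p q : ℂ) • (w p * w q) := by
  rw [h.mul, smul_smul, circle_star_mul_self, one_smul]

theorem rangeProj_zero (h : IsIsometricRep σ w) : rangeProj w 0 = 1 := by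
  simp only [rangeProj, h.apply_zero, star_smul, star_one, smul_mul_smul_comm,
    circle_mul_star_self, mul_one, one_smul]

theorem conj_rangeProj (h : IsIsometricRep σ w) (p q : Fin n → ℕ) :
    w p * rangeProj w q * star (w p) = rangeProj w (p + q) := by
  have : w p * rangeProj w q * star (w p) = (w p * w q) * star (w p * w q) := by
    simp only [rangeProj, star_mul, mul_assoc]
  rw [this, h.mul, star_smul, smul_mul_smul_comm, circle_mul_star_self, one_smul, rangeProj]

theorem rangeProj_mul_self (h : IsIsometricRep σ w) (p : Fin n → ℕ) :
    rangeProj w p * rangeProj w p = rangeProj w p := by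
  simp only [rangeProj]
  rw [mul_assoc, ← mul_assoc (star (w p)), h.isometry, one_mul]

theorem norm_rangeProj_le (h : IsIsometricRep σ w) (p : Fin n → ℕ) : ‖rangeProj w p‖ ≤ 1 :=
  IsStarProjection.norm_le _ ⟨h.rangeProj_mul_self p, star_rangeProj w p⟩

/-- Both `w p * w (p ⊔ q - p)` and `w q * w (p ⊔ q - q)` are unimodular multiples of `w (p ⊔ q)`.
Sandwiching covariance between `w p` and `star (w q)` gives Nica covariance; sandwiching the latter
between `star (w p)` and `w q` undoes this, as these are isometries. -/
theorem isCovariant_iff (h : IsIsometricRep σ w) : IsCovariant σ w ↔ IsNicaCovariant w := by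
  have key (p q : Fin n → ℕ) : w (p ⊔ q) = star (σ p (p ⊔ q - p) : ℂ) • (w p * w (p ⊔ q - p)) := by
    rw [← h.apply_add, add_tsub_cancel_of_le le_sup_left]
  have key' (p q : Fin n → ℕ) : w (p ⊔ q) = star (σ q (p ⊔ q - q) : ℂ) • (w q * w (p ⊔ q - q)) := by
    rw [← h.apply_add, add_tsub_cancel_of_le le_sup_right]
  have iso (p : Fin n → ℕ) (x : B) : star (w p) * (w p * x) = x := by
    rw [← mul_assoc, h.isometry, one_mul]
  constructor
  · intro hc p q
    calc w p * star (w p) * (w q * star (w q)) = w p * (star (w p) * w q) * star (w q) := by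
          simp only [mul_assoc]
      _ = (star (σ p (p ⊔ q - p) : ℂ) • (w p * w (p ⊔ q - p))) *
            star (star (σ q (p ⊔ q - q) : ℂ) • (w q * w (p ⊔ q - q))) := by
          rw [hc p q]
          simp only [star_smul, star_mul, star_star, mul_smul_comm, smul_mul_assoc, mul_assoc,
            smul_smul]
          rw [mul_comm (star (σ p _ : ℂ))]
      _ = _ := by rw [← key, ← key']
  · intro hn p q
    calc star (w p) * w q = star (w p) * (w p * star (w p) * (w q * star (w q))) * w q := by
          simp only [mul_assoc, iso, h.isometry, mul_one]
      _ = star (w p) * (w (p ⊔ q) * star (w (p ⊔ q))) * w q := by rw [hn]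
      _ = star (w p) * ((star (σ p (p ⊔ q - p) : ℂ) • (w p * w (p ⊔ q - p))) *
            star (star (σ q (p ⊔ q - q) : ℂ) • (w q * w (p ⊔ q - q)))) * w q := by
          rw [← key, ← key']
      _ = _ := by
          simp only [star_smul, star_mul, star_star, mul_smul_comm, smul_mul_assoc, mul_assoc,
            iso, h.isometry, mul_one, smul_smul]
          rw [mul_comm (star (σ p _ : ℂ))]

end IsIsometricRep

theorem IsNicaCovariant.rangeProj_mul (h : IsNicaCovariant w) (p q : Fin n → ℕ) :
    rangeProj w p * rangeProj w q = rangeProj w (p ⊔ q) := h p q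

end Representations

/-! ### A commutative model of the range projections, where unordered products make sense. -/

/-- The commutative monoid `(ℕⁿ, ∨)`, written multiplicatively. -/
def SupMonoid (n : ℕ) : Type := Fin n → ℕ

instance (n : ℕ) : CommMonoid (SupMonoid n) where
  mul p q := fun j => max (p j) (q j)
  one := fun _ => 0
  mul_assoc p q r := funext fun _ => max_assoc _ _ _
  mul_comm p q := funext fun _ => max_comm _ _
  one_mul p := funext fun _ => max_eq_right (Nat.zero_le _)
  mul_one p := funext fun _ => max_eq_left (Nat.zero_le _)

section Evaluation

variable {n : ℕ} {σ : (Fin n → ℕ) → (Fin n → ℕ) → Circle} {B : Type*} [CStarAlgebra B]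
  {w : (Fin n → ℕ) → B}

/-- The universal commutative algebra generated by projections indexed by `(ℕⁿ, ∨)`. -/
abbrev SupAlgebra (n : ℕ) : Type := MonoidAlgebra ℂ (SupMonoid n)

/-- The generator of `SupAlgebra n` with index `p`. -/
def supGen {n : ℕ} (p : Fin n → ℕ) : SupAlgebra n := MonoidAlgebra.of ℂ (SupMonoid n) p

theorem supGen_mul (p q : Fin n → ℕ) : supGen p * supGen q = supGen (p ⊔ q) :=
  ((MonoidAlgebra.of ℂ (SupMonoid n)).map_mul p q).symm

theorem supGen_zero : supGen (0 : Fin n → ℕ) = 1 :=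
  map_one (MonoidAlgebra.of ℂ (SupMonoid n))

/-- Evaluation of `SupAlgebra n` at the range projections of a Nica covariant representation. -/
def supEval (h : IsIsometricRep σ w) (hn : IsNicaCovariant w) : SupAlgebra n →ₐ[ℂ] B :=
  MonoidAlgebra.lift ℂ B (SupMonoid n)
    { toFun := rangeProj w
      map_one' := h.rangeProj_zero
      map_mul' := fun p q => (hn.rangeProj_mul p q).symm }

theorem supEval_supGen (h : IsIsometricRep σ w) (hn : IsNicaCovariant w) (p : Fin n → ℕ) :
    supEval h hn (supGen p) = rangeProj w p := by
  exact MonoidAlgebra.lift_of _ _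

/-- The projection of `SupAlgebra n` belonging to `a e_j`. -/
def axisProj (j : Fin n) (a : ℕ) : SupAlgebra n := supGen (Pi.single j a)

theorem axisProj_zero (j : Fin n) : axisProj j 0 = 1 := by
  rw [axisProj, Pi.single_zero]; exact supGen_zero

theorem axisProj_mul (j : Fin n) (a b : ℕ) :
    axisProj j a * axisProj j b = axisProj j (max a b) := by
  rw [axisProj, axisProj, supGen_mul, axisProj]
  congr 1
  ext i
  by_cases hi : i = j
  · subst hi; simp
  · simp [hi]

theorem supGen_eq_prod (t : Fin n → ℕ) : supGen t = ∏ j, axisProj j (t j) := by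
  have key (s : Finset (Fin n)) :
      ∏ j ∈ s, axisProj j (t j) = supGen (fun j => if j ∈ s then t j else 0) := by
    induction s using Finset.induction_on with
    | empty => exact supGen_zero.symm
    | insert a s ha ih =>
      rw [Finset.prod_insert ha, ih, axisProj, supGen_mul]
      congr 1
      ext i
      by_cases hi : i = a
      · subst hi; simp [ha]
      · simp [hi]
  simp [key]

end Evaluation

/-! ### Telescoping sums of conjugated defect products. -/

section Telescoping

variable {n : ℕ} {σ : (Fin n → ℕ) → (Fin n → ℕ) → Circle} {B : Type*} [CStarAlgebra B]
  {w : (Fin n → ℕ) → B}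

theorem supGen_mul_axisProj (t : Fin n → ℕ) (j : Fin n) :
    supGen t * axisProj j (t j + 1) = supGen (t + Pi.single j 1) := by
  rw [axisProj, supGen_mul]
  congr 1
  ext i
  by_cases hi : i = j
  · subst hi; simp
  · simp [hi]

/-- Conjugation by the isometry `w t` is multiplicative and shifts range projections by `t`;
moreover the projection of `t + e_j` is that of `t` times that of `(t j + 1) e_j`. -/
theorem conj_supEval_prod (h : IsIsometricRep σ w) (hn : IsNicaCovariant w) (c : ℂ)
    (t : Fin n → ℕ) (S : Finset (Fin n)) :
    w t * supEval h hn (∏ j ∈ S, (1 - c • axisProj j 1)) * star (w t) =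
      supEval h hn (supGen t * ∏ j ∈ S, (1 - c • axisProj j (t j + 1))) := by
  induction S using Finset.induction_on with
  | empty => simp [supEval_supGen, rangeProj]
  | insert j S hj ih =>
    have hfac : w t * supEval h hn (1 - c • axisProj j 1) * star (w t) =
        supEval h hn (supGen t * (1 - c • axisProj j (t j + 1))) := by
      rw [mul_sub, mul_one, mul_smul_comm, supGen_mul_axisProj]
      simp only [map_sub, map_one, map_smul, axisProj, supEval_supGen, mul_sub, sub_mul, mul_one,
        mul_smul_comm, smul_mul_assoc, h.conj_rangeProj]
      rfl
    have hsplit (x y : B) : w t * (x * y) * star (w t) =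
        (w t * x * star (w t)) * (w t * y * star (w t)) := by
      simp only [mul_assoc]
      rw [← mul_assoc (star (w t)) (w t), h.isometry, one_mul]
    have hidem : supGen t * supGen t = supGen t := by rw [supGen_mul, sup_idem]
    rw [Finset.prod_insert hj, Finset.prod_insert hj, map_mul, hsplit, hfac, ih, ← map_mul]
    congr 1
    calc _ = supGen t * supGen t * ((1 - c • axisProj j (t j + 1)) *
          ∏ j ∈ S, (1 - c • axisProj j (t j + 1))) := by ring
      _ = _ := by rw [hidem]

/-- Each summand factors over the coordinates into differences of consecutive values of `a ↦ c ^ a •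
axisProj j a`. The sum over the box is therefore a product of one-variable telescoping sums. -/
theorem sum_conj_supEval (h : IsIsometricRep σ w) (hn : IsNicaCovariant w) (c : ℂ)
    (M : Fin n → ℕ) :
    ∑ t ∈ Fintype.piFinset fun j => Finset.range (M j), c ^ (∑ j, t j) •
        (w t * supEval h hn (∏ j, (1 - c • axisProj j 1)) * star (w t)) =
      supEval h hn (∏ j, (1 - c ^ M j • axisProj j (M j))) := by
  have hterm (t : Fin n → ℕ) : c ^ (∑ j, t j) •
      (w t * supEval h hn (∏ j, (1 - c • axisProj j 1)) * star (w t)) =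
      supEval h hn (∏ j, (c ^ t j • axisProj j (t j) -
        c ^ (t j + 1) • axisProj j (t j + 1))) := by
    rw [conj_supEval_prod, ← map_smul]
    congr 1
    rw [supGen_eq_prod, ← Finset.prod_mul_distrib, ← Finset.prod_pow_eq_pow_sum,
      ← Finset.prod_smul]
    refine Finset.prod_congr rfl fun j _ => ?_
    rw [mul_sub, mul_one, mul_smul_comm, axisProj_mul, max_eq_right (Nat.le_succ _), smul_sub,
      smul_smul, pow_succ]
  simp_rw [hterm, ← map_sum]
  congr 1
  rw [← Finset.prod_univ_sum (fun j => Finset.range (M j))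
    (fun j a => c ^ a • axisProj j a - c ^ (a + 1) • axisProj j (a + 1))]
  refine Finset.prod_congr rfl fun j _ => ?_
  rw [Finset.sum_range_sub' (fun a => c ^ a • axisProj j a), pow_zero, one_smul, axisProj_zero]

theorem star_supEval_prod (h : IsIsometricRep σ w) (hn : IsNicaCovariant w) (μ : ℝ)
    (S : Finset (Fin n)) :
    star (supEval h hn (∏ j ∈ S, (1 - (μ : ℂ) • axisProj j 1))) =
      supEval h hn (∏ j ∈ S, (1 - (μ : ℂ) • axisProj j 1)) := by
  induction S using Finset.induction_on with
  | empty => simp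
  | insert j S hj ih =>
    have hfac : star (supEval h hn (1 - (μ : ℂ) • axisProj j 1)) =
        supEval h hn (1 - (μ : ℂ) • axisProj j 1) := by
      simp only [map_sub, map_one, map_smul, axisProj, supEval_supGen, star_sub, star_one,
        star_smul, star_rangeProj, Complex.star_def, Complex.conj_ofReal]
    rw [Finset.prod_insert hj, map_mul, star_mul, ih, hfac, ← map_mul, ← map_mul, mul_comm]

/-- For a projection `P`, `(1 - μP)² = 1 - (2μ - μ²)P`. Writing `l² = 2μ - μ²` thus yields an
explicit factorisation of the weight `y`, without functional calculus. -/
theorem supEval_prod_eq_mul_star (h : IsIsometricRep σ w) (hn : IsNicaCovariant w) (μ : ℝ) :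
    supEval h hn (∏ j, (1 - ((2 * μ - μ ^ 2 : ℝ) : ℂ) • axisProj j 1)) =
      supEval h hn (∏ j, (1 - (μ : ℂ) • axisProj j 1)) *
        star (supEval h hn (∏ j, (1 - (μ : ℂ) • axisProj j 1))) := by
  rw [star_supEval_prod, ← map_mul, ← Finset.prod_mul_distrib]
  congr 1
  refine Finset.prod_congr rfl fun j _ => ?_
  have hidem : axisProj j 1 * axisProj j 1 = axisProj j 1 := by rw [axisProj_mul, max_self]
  simp only [mul_sub, sub_mul, mul_one, one_mul, smul_mul_smul_comm, hidem]
  push_cast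
  module

theorem tendsto_supEval_prod (h : IsIsometricRep σ w) (hn : IsNicaCovariant w)
    {c : ℕ → Fin n → ℂ} (hc : ∀ j, Filter.Tendsto (fun k => c k j) Filter.atTop (nhds 0))
    (M : ℕ → Fin n → ℕ) (S : Finset (Fin n)) :
    Filter.Tendsto (fun k => supEval h hn (∏ j ∈ S, (1 - c k j • axisProj j (M k j))))
      Filter.atTop (nhds 1) := by
  induction S using Finset.induction_on with
  | empty => simp
  | insert j S hj ih =>
    simp only [Finset.prod_insert hj, map_mul]
    rw [← one_mul (1 : B)]
    refine Filter.Tendsto.mul ?_ ih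
    simp only [map_sub, map_one, map_smul, axisProj, supEval_supGen]
    have h0 : Filter.Tendsto (fun k => c k j • rangeProj w (Pi.single j (M k j)))
        Filter.atTop (nhds 0) := by
      refine squeeze_zero_norm (a := fun k => ‖c k j‖) (fun k => ?_) (by simpa using (hc j).norm)
      rw [norm_smul]
      exact mul_le_of_le_one_right (norm_nonneg _) (h.norm_rangeProj_le _)
    simpa using tendsto_const_nhds.sub h0

end Telescoping

/-! ### The left regular representation on basis vectors. -/

section RegularRepresentation

variable {n : ℕ} {σ : (Fin n → ℕ) → (Fin n → ℕ) → Circle}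

theorem inner_delta_left (q : Fin n → ℕ) (f : EllTwo n) : inner ℂ (delta q) f = f q := by
  rw [delta, lp.inner_single_left]; simp

theorem inner_delta_delta (q r : Fin n → ℕ) :
    inner ℂ (delta q) (delta r : EllTwo n) = if q = r then 1 else 0 := by
  rw [inner_delta_left, delta, lp.single_apply, Pi.single_apply]

theorem ellTwo_ext {f g : EllTwo n} (h : ∀ q, inner ℂ (delta q) f = inner ℂ (delta q) g) :
    f = g := by
  ext q
  simpa [inner_delta_left] using h q

/-- The adjoints agree because all their coordinates do, so no density argument for the basis is
needed. -/
theorem clm_ext_delta {S T : EllTwo n →L[ℂ] EllTwo n}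
    (h : ∀ q, S (delta q) = T (delta q)) : S = T := by
  have hadj : star S = star T := by
    refine ContinuousLinearMap.ext fun f => ellTwo_ext fun q => ?_
    rw [ContinuousLinearMap.star_eq_adjoint, ContinuousLinearMap.star_eq_adjoint,
      ContinuousLinearMap.adjoint_inner_right, ContinuousLinearMap.adjoint_inner_right, h]
  exact star_injective hadj

theorem star_leftRegular_mul_self (p : Fin n → ℕ) :
    star (leftRegular σ p) * leftRegular σ p = 1 := by
  rw [ContinuousLinearMap.star_eq_adjoint]
  exact (ContinuousLinearMap.norm_map_iff_adjoint_comp_self _).1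
    (orthonormal_shift σ p).orthogonalFamily.linearIsometry.norm_map

theorem star_leftRegular_delta_add (p t : Fin n → ℕ) :
    star (leftRegular σ p) (delta (p + t)) = star (σ p t : ℂ) • delta t := by
  have h1 : (delta (p + t) : EllTwo n) = star (σ p t : ℂ) • leftRegular σ p (delta t) := by
    rw [leftRegular_delta, smul_smul, circle_star_mul_self, one_smul]
  rw [h1, map_smul, ← mul_apply_eq_comp, star_leftRegular_mul_self,
    one_apply_eq_self]

theorem star_leftRegular_delta_of_not_le {p r : Fin n → ℕ} (h : ¬ p ≤ r) :
    star (leftRegular σ p) (delta r) = 0 := by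
  refine ellTwo_ext fun t => ?_
  rw [ContinuousLinearMap.star_eq_adjoint, ContinuousLinearMap.adjoint_inner_right,
    leftRegular_delta, inner_smul_left, inner_delta_delta, if_neg, mul_zero, inner_zero_right]
  rintro rfl
  exact h le_self_add

theorem leftRegular_mul (hσ : IsCocycle σ) (p q : Fin n → ℕ) :
    leftRegular σ p * leftRegular σ q = (σ p q : ℂ) • leftRegular σ (p + q) := by
  refine clm_ext_delta fun r => ?_
  have := congrArg (fun z : Circle => (z : ℂ)) (hσ p q r)
  simp only [Circle.coe_mul] at this
  rw [mul_apply_eq_comp, smul_apply, leftRegular_delta, map_smul,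
    leftRegular_delta, leftRegular_delta, smul_smul, smul_smul, this, add_assoc, mul_comm]

open Classical in
theorem leftRegular_rangeProj_delta (p s : Fin n → ℕ) :
    (leftRegular σ p * star (leftRegular σ p)) (delta s) = if p ≤ s then delta s else 0 := by
  rw [mul_apply_eq_comp]
  split_ifs with h
  · obtain ⟨t, rfl⟩ := le_iff_exists_add.1 h
    rw [star_leftRegular_delta_add, map_smul, leftRegular_delta, smul_smul, circle_star_mul_self,
      one_smul]
  · rw [star_leftRegular_delta_of_not_le h, map_zero]

theorem isIsometricRep_toeplitzGen (hσ : IsCocycle σ) : IsIsometricRep σ (toeplitzGen σ) where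
  isometry p := Subtype.ext (star_leftRegular_mul_self p)
  mul p q := Subtype.ext (leftRegular_mul hσ p q)

theorem isNicaCovariant_toeplitzGen (σ : (Fin n → ℕ) → (Fin n → ℕ) → Circle) :
    IsNicaCovariant (toeplitzGen σ) := by
  refine fun p q => Subtype.ext (clm_ext_delta fun s => ?_)
  change ((leftRegular σ p * star (leftRegular σ p)) *
    (leftRegular σ q * star (leftRegular σ q))) (delta s) =
    (leftRegular σ (p ⊔ q) * star (leftRegular σ (p ⊔ q))) (delta s)
  classical
  rw [mul_apply_eq_comp, leftRegular_rangeProj_delta, leftRegular_rangeProj_delta]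
  by_cases hq : q ≤ s
  · rw [if_pos hq, leftRegular_rangeProj_delta]
    simp [hq]
  · simp [hq]

theorem isCovariant_toeplitzGen (hσ : IsCocycle σ) : IsCovariant σ (toeplitzGen σ) :=
  (isIsometricRep_toeplitzGen hσ).isCovariant_iff.2 (isNicaCovariant_toeplitzGen σ)

end RegularRepresentation

/-! ### Positive maps and their norm bounds. -/

section Positivity

open scoped ComplexOrder in
-- Factoring `A = Cᴴ * C` rewrites the double sum as a sum of elements `u * star u`.
theorem sum_posSemidef_nonneg {ι B : Type*} [Fintype ι] [CStarAlgebra B] [PartialOrder B]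
    [StarOrderedRing B] {A : Matrix ι ι ℂ} (hA : A.PosSemidef) (x : ι → B) :
    0 ≤ ∑ i, ∑ j, A i j • (x i * star (x j)) := by
  classical
  obtain ⟨C, rfl⟩ : ∃ C : Matrix ι ι ℂ, A = Cᴴ * C := by
    open scoped MatrixOrder in
    exact (CStarAlgebra.nonneg_iff_eq_star_mul_self (a := A)).1 hA.nonneg
  have : ∑ i, ∑ j, (Cᴴ * C) i j • (x i * star (x j)) =
      ∑ k, (∑ i, star (C k i) • x i) * star (∑ i, star (C k i) • x i) := by
    simp only [Matrix.mul_apply, Matrix.conjTranspose_apply, Finset.sum_smul, star_sum,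
      Finset.sum_mul_sum, star_smul, star_star, smul_mul_smul_comm]
    rw [Finset.sum_congr rfl fun i _ => Finset.sum_comm, Finset.sum_comm]
  rw [this]
  exact Finset.sum_nonneg fun k _ => mul_star_self_nonneg _

theorem exists_eq_star_mul_self_of_nonneg {A : Type*} [CStarAlgebra A] [PartialOrder A]
    [StarOrderedRing A] {a : A} (ha : 0 ≤ a) : ∃ s, a = star s * s :=
  CStarAlgebra.nonneg_iff_eq_star_mul_self.1 ha

/-- Every element is a combination of four positive ones of no larger norm, whence the `4`. The
constant is not sharp; only uniformity along the approximating sequence matters. -/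
theorem norm_apply_le_of_positive {A B : Type*} [CStarAlgebra A] [PartialOrder A]
    [StarOrderedRing A] [CStarAlgebra B] [PartialOrder B] [StarOrderedRing B]
    (f : A →ₗ[ℂ] B) (hf : ∀ a, 0 ≤ a → 0 ≤ f a) (a : A) : ‖f a‖ ≤ 4 * ‖f 1‖ * ‖a‖ := by
  let g : A →ₚ[ℂ] B := PositiveLinearMap.mk₀ f hf
  obtain ⟨y, hy, hy', hsum⟩ := CStarAlgebra.exists_sum_four_nonneg a
  calc ‖f a‖ = ‖∑ i : Fin 4, Complex.I ^ (i : ℕ) • f (y i)‖ := by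
        conv_lhs => rw [hsum]
        simp only [map_sum, map_smul]
    _ ≤ ∑ i : Fin 4, ‖Complex.I ^ (i : ℕ) • f (y i)‖ := norm_sum_le _ _
    _ ≤ ∑ _i : Fin 4, ‖f 1‖ * ‖a‖ := by
        refine Finset.sum_le_sum fun i _ => ?_
        rw [norm_smul, norm_pow, Complex.norm_I, one_pow, one_mul]
        exact (g.norm_apply_le_of_nonneg _ (hy i)).trans
          (mul_le_mul_of_nonneg_left (hy' i) (norm_nonneg _))
    _ = _ := by simp; ring

end Positivity

/-! ### The truncated Poisson maps and their limits. -/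

section Poisson

variable {n : ℕ} {σ : (Fin n → ℕ) → (Fin n → ℕ) → Circle} {B : Type*} [CStarAlgebra B]
  {w : (Fin n → ℕ) → B}

/-- The box `{0, …, N - 1}ⁿ`. -/
def box (n N : ℕ) : Finset (Fin n → ℕ) := Fintype.piFinset fun _ => Finset.range N

theorem mem_box {N : ℕ} {r : Fin n → ℕ} : r ∈ box n N ↔ ∀ j, r j < N := by simp [box]

/-- The truncated Poisson map
`T ↦ ∑ ⟨δ_r, T δ_s⟩ l^{|r| + |s|} w_r y w_s*`, the sum being over a box. -/
def poissonMap (w : (Fin n → ℕ) → B) (y : B) (l : ℝ) (N : ℕ) :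
    (EllTwo n →L[ℂ] EllTwo n) →ₗ[ℂ] B where
  toFun T := ∑ r ∈ box n N, ∑ s ∈ box n N,
    (inner ℂ (delta r) (T (delta s)) * (l : ℂ) ^ (∑ j, r j + ∑ j, s j)) • (w r * y * star (w s))
  map_add' S T := by
    simp only [← Finset.sum_add_distrib, ← add_smul, ← add_mul, ← inner_add_right]
    rfl
  map_smul' c T := by
    simp only [Finset.smul_sum, smul_smul, RingHom.id_apply, ← mul_assoc, ← inner_smul_right]
    rfl

theorem poissonMap_apply (w : (Fin n → ℕ) → B) (y : B) (l : ℝ) (N : ℕ)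
    (T : EllTwo n →L[ℂ] EllTwo n) :
    poissonMap w y l N T = ∑ r ∈ box n N, ∑ s ∈ box n N,
      (inner ℂ (delta r) (T (delta s)) * (l : ℂ) ^ (∑ j, r j + ∑ j, s j)) •
        (w r * y * star (w s)) := rfl

open scoped ComplexOrder in
theorem poissonMap_nonneg [PartialOrder B] [StarOrderedRing B] (w : (Fin n → ℕ) → B) (z : B)
    (l : ℝ) (N : ℕ) {T : EllTwo n →L[ℂ] EllTwo n} (hT : 0 ≤ T) :
    0 ≤ poissonMap w (z * star z) l N T := by
  obtain ⟨S, rfl⟩ := exists_eq_star_mul_self_of_nonneg hT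
  -- With `T = S*S`, the entries `⟨δ_r, T δ_s⟩` are the Gram matrix of the vectors `S δ_r`; the
  -- powers of `l` and the factor `z` are absorbed into the elements of `B`.
  have hpsd := Matrix.posSemidef_gram ℂ (fun r : box n N => S (delta (r : Fin n → ℕ)))
  have := sum_posSemidef_nonneg hpsd
    (fun r : box n N => (l : ℂ) ^ (∑ j, (r : Fin n → ℕ) j) • (w r * z))
  convert this using 1
  rw [poissonMap_apply, ← Finset.sum_coe_sort (box n N)]
  refine Finset.sum_congr rfl fun r _ => ?_
  rw [← Finset.sum_coe_sort (box n N)]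
  refine Finset.sum_congr rfl fun s _ => ?_
  rw [Matrix.gram_apply, mul_apply_eq_comp, ContinuousLinearMap.star_eq_adjoint,
    ContinuousLinearMap.adjoint_inner_right, star_smul, smul_mul_smul_comm, smul_smul, star_pow,
    Complex.star_def, Complex.conj_ofReal, pow_add, star_mul]
  simp only [mul_assoc]

theorem inner_leftRegular_mul_star (p q r s : Fin n → ℕ) :
    inner ℂ (delta r) ((leftRegular σ p * star (leftRegular σ q)) (delta s)) =
      inner ℂ (star (leftRegular σ p) (delta r)) (star (leftRegular σ q) (delta s)) := by
  rw [mul_apply_eq_comp, ContinuousLinearMap.star_eq_adjoint (leftRegular σ p),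
    ContinuousLinearMap.adjoint_inner_left]

theorem exists_of_inner_leftRegular_ne_zero {p q r s : Fin n → ℕ}
    (h : inner ℂ (delta r) ((leftRegular σ p * star (leftRegular σ q)) (delta s)) ≠ 0) :
    ∃ t, r = p + t ∧ s = q + t := by
  rw [inner_leftRegular_mul_star] at h
  have hp : p ≤ r := by
    by_contra hp
    rw [star_leftRegular_delta_of_not_le hp, inner_zero_left] at h
    exact h rfl
  have hq : q ≤ s := by
    by_contra hq
    rw [star_leftRegular_delta_of_not_le hq, inner_zero_right] at h
    exact h rfl
  obtain ⟨t, rfl⟩ := le_iff_exists_add.1 hp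
  obtain ⟨u, rfl⟩ := le_iff_exists_add.1 hq
  rw [star_leftRegular_delta_add, star_leftRegular_delta_add, inner_smul_left, inner_smul_right,
    inner_delta_delta] at h
  refine ⟨t, rfl, ?_⟩
  by_contra htu
  rw [if_neg (fun e => htu (by rw [e]))] at h
  simp at h

theorem inner_leftRegular_add (p q t : Fin n → ℕ) :
    inner ℂ (delta (p + t)) ((leftRegular σ p * star (leftRegular σ q)) (delta (q + t))) =
      (σ p t : ℂ) * star (σ q t : ℂ) := by
  rw [inner_leftRegular_mul_star, star_leftRegular_delta_add, star_leftRegular_delta_add,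
    inner_smul_left, inner_smul_right, inner_delta_delta, if_pos rfl, mul_one]
  simp

/-- The matrix of `L_p L_q*` lives on the pairs `(p + t, q + t)`, with entry `σ p t * star (σ q t)`.
These phases cancel those produced by splitting `w (p + t)` and `w (q + t)`. -/
theorem poissonMap_leftRegular_eq_sum (h : IsIsometricRep σ w) (y : B) (l : ℝ) (N : ℕ)
    (p q : Fin n → ℕ) :
    poissonMap w y l N (leftRegular σ p * star (leftRegular σ q)) =
      (l : ℂ) ^ (∑ j, p j + ∑ j, q j) •
        (w p * (∑ t ∈ Fintype.piFinset fun j => Finset.range (N - (p ⊔ q) j),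
          ((l : ℂ) ^ 2) ^ (∑ j, t j) • (w t * y * star (w t))) * star (w q)) := by
  classical
  set D := Fintype.piFinset fun j => Finset.range (N - (p ⊔ q) j) with hD
  -- Truncated subtraction is harmless: if `N ≤ (p ⊔ q) j` for some `j`, both sides are false.
  have hmem (t : Fin n → ℕ) : t ∈ D ↔ p + t ∈ box n N ∧ q + t ∈ box n N := by
    simp only [hD, Fintype.mem_piFinset, Finset.mem_range, mem_box, Pi.add_apply, Pi.sup_apply,
      ← forall_and]
    refine forall_congr' fun j => ?_
    rcases le_total (p j) (q j) with hpq | hpq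
    · rw [sup_eq_right.2 hpq]; omega
    · rw [sup_eq_left.2 hpq]; omega
  rw [poissonMap_apply, ← Finset.sum_product']
  have hinj : Set.InjOn (fun t : Fin n → ℕ => (p + t, q + t)) D := fun t _ u _ e =>
    add_left_cancel (congrArg Prod.fst e)
  have hsub : D.image (fun t => (p + t, q + t)) ⊆ box n N ×ˢ box n N := by
    intro x hx
    obtain ⟨t, ht, rfl⟩ := Finset.mem_image.1 hx
    exact Finset.mem_product.2 ((hmem t).1 ht)
  rw [← Finset.sum_subset hsub, Finset.sum_image hinj, Finset.mul_sum, Finset.sum_mul,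
    Finset.smul_sum]
  · refine Finset.sum_congr rfl fun t _ => ?_
    have hexp : (l : ℂ) ^ (∑ j, (p + t) j + ∑ j, (q + t) j) =
        (l : ℂ) ^ (∑ j, p j + ∑ j, q j) * ((l : ℂ) ^ 2) ^ (∑ j, t j) := by
      rw [← pow_mul, ← pow_add]
      congr 1
      simp only [Pi.add_apply, Finset.sum_add_distrib]
      ring
    have hscal : ((σ p t : ℂ) * star (σ q t : ℂ)) * (star (σ p t : ℂ) * (σ q t : ℂ)) = 1 := by
      linear_combination (star (σ q t : ℂ) * (σ q t : ℂ)) * circle_star_mul_self (σ p t) +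
        circle_star_mul_self (σ q t)
    rw [inner_leftRegular_add, hexp, h.apply_add, h.apply_add]
    simp only [star_smul, star_mul, star_star, smul_mul_assoc, mul_smul_comm, smul_smul, mul_assoc]
    congr 1
    linear_combination ((l : ℂ) ^ (∑ j, p j + ∑ j, q j) * ((l : ℂ) ^ 2) ^ (∑ j, t j)) * hscal
  · rintro ⟨r, s⟩ hrs hnot
    have : inner ℂ (delta r) ((leftRegular σ p * star (leftRegular σ q)) (delta s)) = 0 := by
      by_contra hne
      obtain ⟨t, rfl, rfl⟩ := exists_of_inner_leftRegular_ne_zero hne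
      exact hnot (Finset.mem_image.2 ⟨t, (hmem t).2 (Finset.mem_product.1 hrs), rfl⟩)
    simp only [this, zero_mul, zero_smul]

theorem exists_poisson_parameters : ∃ (μ l : ℕ → ℝ) (N : ℕ → ℕ),
    (∀ k, l k ^ 2 = 2 * μ k - μ k ^ 2) ∧
    Filter.Tendsto l Filter.atTop (nhds 1) ∧
    ∀ m : ℕ, Filter.Tendsto (fun k => ((l k : ℂ) ^ 2) ^ (N k - m)) Filter.atTop (nhds 0) := by
  have hμ : Filter.Tendsto (fun k : ℕ => (1 : ℝ) / ((k : ℝ) + 1)) Filter.atTop (nhds 0) :=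
    tendsto_one_div_add_atTop_nhds_zero_nat
  have hpos (k : ℕ) : (0 : ℝ) < 1 / ((k : ℝ) + 1) := by positivity
  have hle (k : ℕ) : (1 : ℝ) / ((k : ℝ) + 1) ≤ 1 := by
    rw [div_le_one (by positivity)]
    have : (0 : ℝ) ≤ k := k.cast_nonneg
    linarith
  have hlt (k : ℕ) : (1 : ℝ) - (1 / ((k : ℝ) + 1)) ^ 2 < 1 := by
    have := pow_pos (hpos k) 2
    linarith
  have h0 (k : ℕ) : (0 : ℝ) ≤ 1 - (1 / ((k : ℝ) + 1)) ^ 2 := by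
    have := pow_le_one₀ (n := 2) (hpos k).le (hle k)
    linarith
  choose N₀ hN₀ using fun k : ℕ => exists_pow_lt_of_lt_one (hpos k) (hlt k)
  -- With `ε = 1 / (k + 1)` and `μ = 1 - ε`, `2μ - μ² = 1 - ε² = l²`. The exponent `N₀ k` makes
  -- `(l²) ^ N₀ k < ε`, and the extra `k` absorbs the shift by `m` once `k ≥ m`.
  refine ⟨fun k => 1 - 1 / ((k : ℝ) + 1), fun k => √(1 - (1 / ((k : ℝ) + 1)) ^ 2),
    fun k => N₀ k + k, fun k => ?_, ?_, fun m => ?_⟩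
  · rw [Real.sq_sqrt (h0 k)]; ring
  · have := (tendsto_const_nhds (x := (1 : ℝ))).sub (hμ.pow 2)
    simpa using this.sqrt
  · refine squeeze_zero_norm' (a := fun k : ℕ => (1 : ℝ) / ((k : ℝ) + 1)) ?_ hμ
    filter_upwards [Filter.eventually_ge_atTop m] with k hk
    rw [← Complex.ofReal_pow, Real.sq_sqrt (h0 k), ← Complex.ofReal_pow, Complex.norm_real,
      Real.norm_of_nonneg (pow_nonneg (h0 k) _)]
    exact (pow_le_pow_of_le_one (h0 k) (hlt k).le (by omega)).trans (hN₀ k).le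

/-- An approximate version of the homomorphism `L_p ↦ w_p`: uniformly bounded linear maps that
converge to `w_p w_q*` at `L_p L_q*`. -/
theorem exists_approx (h : IsIsometricRep σ w) (hn : IsNicaCovariant w) :
    ∃ (Φ : ℕ → (EllTwo n →L[ℂ] EllTwo n) →ₗ[ℂ] B) (C : ℝ), (∀ k T, ‖Φ k T‖ ≤ C * ‖T‖) ∧
      ∀ p q, Filter.Tendsto (fun k => Φ k (leftRegular σ p * star (leftRegular σ q)))
        Filter.atTop (nhds (w p * star (w q))) := by
  let _ := CStarAlgebra.spectralOrder B
  have := CStarAlgebra.spectralOrderedRing B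
  obtain ⟨μ, l, N, hlμ, hl, hN⟩ := exists_poisson_parameters
  let y (k : ℕ) : B := supEval h hn (∏ j, (1 - ((l k : ℂ) ^ 2) • axisProj j 1))
  have hy (k : ℕ) : ∃ z, y k = z * star z := by
    refine ⟨_, Eq.trans ?_ (supEval_prod_eq_mul_star h hn (μ k))⟩
    simp only [y]
    rw [← hlμ, Complex.ofReal_pow]
  let Φ (k : ℕ) := poissonMap w (y k) (l k) (N k)
  have hconv (p q : Fin n → ℕ) :
      Filter.Tendsto (fun k => Φ k (leftRegular σ p * star (leftRegular σ q)))
        Filter.atTop (nhds (w p * star (w q))) := by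
    simp only [Φ, y, poissonMap_leftRegular_eq_sum h, sum_conj_supEval h hn]
    have h1 : Filter.Tendsto (fun k => (l k : ℂ) ^ (∑ j, p j + ∑ j, q j)) Filter.atTop
        (nhds 1) := by
      simpa using ((Complex.continuous_ofReal.tendsto 1).comp hl).pow (∑ j, p j + ∑ j, q j)
    have h2 := tendsto_supEval_prod h hn (c := fun k j => ((l k : ℂ) ^ 2) ^ (N k - (p ⊔ q) j))
      (fun j => hN _) (fun k j => N k - (p ⊔ q) j) Finset.univ
    simpa using h1.smul ((h2.const_mul (w p)).mul_const (star (w q)))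
  -- Convergence at `p = q = 0` is convergence of `Φ k 1`, which bounds `‖Φ k 1‖` and hence, by
  -- positivity, all `Φ k` uniformly.
  have hone : leftRegular σ 0 * star (leftRegular σ 0) = 1 := by
    classical
    refine clm_ext_delta fun s => ?_
    rw [leftRegular_rangeProj_delta,
      if_pos (show (0 : Fin n → ℕ) ≤ s from fun j => Nat.zero_le (s j)), one_apply_eq_self]
  obtain ⟨C, hC⟩ := (hconv 0 0).norm.bddAbove_range
  rw [hone] at hC
  refine ⟨Φ, 4 * C, fun k T => ?_, hconv⟩
  have hpos : ∀ T, 0 ≤ T → 0 ≤ Φ k T := by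
    intro T hT
    obtain ⟨z, hz⟩ := hy k
    simp only [Φ, hz]
    exact poissonMap_nonneg w z (l k) (N k) hT
  refine (norm_apply_le_of_positive (Φ k) hpos T).trans ?_
  gcongr
  exact hC ⟨k, rfl⟩

end Poisson

/-! ### Pointwise limits of uniformly bounded linear maps. -/

section Limits

variable {E F : Type*} [NormedAddCommGroup E] [NormedSpace ℂ E] [NormedAddCommGroup F]
  [NormedSpace ℂ F]

/-- The vectors at which a sequence of linear maps converges. -/
def convergenceSubmodule (Φ : ℕ → E →ₗ[ℂ] F) : Submodule ℂ E where
  carrier := {x | ∃ b, Filter.Tendsto (fun k => Φ k x) Filter.atTop (nhds b)}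
  zero_mem' := ⟨0, by simp⟩
  add_mem' := by
    rintro x y ⟨a, ha⟩ ⟨b, hb⟩
    exact ⟨a + b, by simpa using ha.add hb⟩
  smul_mem' := by
    rintro c x ⟨a, ha⟩
    exact ⟨c • a, by simpa using ha.const_smul c⟩

theorem isClosed_convergenceSubmodule [CompleteSpace F] {Φ : ℕ → E →ₗ[ℂ] F} {C : ℝ}
    (hΦ : ∀ k x, ‖Φ k x‖ ≤ C * ‖x‖) : IsClosed (convergenceSubmodule Φ : Set E) := by
  refine isClosed_of_closure_subset fun x hx => ?_
  refine cauchySeq_tendsto_of_complete (Metric.cauchySeq_iff'.2 fun ε hε => ?_)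
  -- `C` may be zero or negative; `|C| + 1` is a safe denominator for the three-epsilon argument.
  have hC : 0 < |C| + 1 := by positivity
  obtain ⟨y, ⟨b, hb⟩, hxy⟩ := Metric.mem_closure_iff.1 hx (ε / (3 * (|C| + 1))) (by positivity)
  have hclose (k : ℕ) : dist (Φ k x) (Φ k y) < ε / 3 := by
    rw [dist_eq_norm, ← map_sub]
    calc ‖Φ k (x - y)‖ ≤ C * ‖x - y‖ := hΦ _ _
      _ ≤ (|C| + 1) * ‖x - y‖ := by
          gcongr
          exact (le_abs_self C).trans (by linarith)
      _ < (|C| + 1) * (ε / (3 * (|C| + 1))) := by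
          gcongr
          rwa [← dist_eq_norm]
      _ = ε / 3 := by field_simp
  obtain ⟨N, hN⟩ := Metric.cauchySeq_iff'.1 hb.cauchySeq (ε / 3) (by positivity)
  refine ⟨N, fun k hk => ?_⟩
  have h1 := hclose k
  have h2 := hN k hk
  have h3 := hclose N
  rw [dist_comm] at h3
  have h4 := dist_triangle4 (Φ k x) (Φ k y) (Φ N y) (Φ N x)
  linarith

theorem exists_limit [CompleteSpace F] {Φ : ℕ → E →ₗ[ℂ] F} {C : ℝ}
    (hΦ : ∀ k x, ‖Φ k x‖ ≤ C * ‖x‖) (htop : convergenceSubmodule Φ = ⊤) :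
    ∃ f : E →L[ℂ] F, ∀ x, Filter.Tendsto (fun k => Φ k x) Filter.atTop (nhds (f x)) := by
  have hex (x : E) : ∃ b, Filter.Tendsto (fun k => Φ k x) Filter.atTop (nhds b) := by
    have : x ∈ convergenceSubmodule Φ := htop ▸ Submodule.mem_top
    exact this
  choose f hf using hex
  refine ⟨LinearMap.mkContinuous
    { toFun := f
      map_add' := fun x y => tendsto_nhds_unique (hf _) (by simpa using (hf x).add (hf y))
      map_smul' := fun c x => tendsto_nhds_unique (hf _) (by simpa using (hf x).const_smul c) }
    C fun x => ?_, hf⟩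
  exact le_of_tendsto (hf x).norm (Filter.Eventually.of_forall fun k => hΦ k x)

end Limits

/-! ### Density of the span of the monomials `L_p L_q*`. -/

section Density

variable {n : ℕ} {σ : (Fin n → ℕ) → (Fin n → ℕ) → Circle}

theorem cstarGen_eq_top_iff {A : Type*} [CStarAlgebra A] {S : Set A} :
    cstarGen S = ⊤ ↔ ∀ T : StarSubalgebra ℂ A, IsClosed (T : Set A) → S ⊆ T → T = ⊤ := by
  constructor
  · intro h T hT hS
    rw [eq_top_iff, ← h]
    exact StarSubalgebra.topologicalClosure_minimal (StarAlgebra.adjoin_le hS) hT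
  · intro h
    exact h _ (StarSubalgebra.isClosed_topologicalClosure _)
      ((StarAlgebra.subset_adjoin ℂ S).trans (StarSubalgebra.le_topologicalClosure _))

theorem cstarGen_range_toeplitzGen (σ : (Fin n → ℕ) → (Fin n → ℕ) → Circle) :
    cstarGen (Set.range (toeplitzGen σ)) = ⊤ := by
  rw [eq_top_iff]
  rintro x -
  change x ∈ closure ((StarAlgebra.adjoin ℂ (Set.range (toeplitzGen σ)) : Set (toeplitz σ)))
  rw [closure_subtype]
  refine closure_mono ?_ x.2
  have himage : (toeplitz σ).subtype '' Set.range (toeplitzGen σ) =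
      Set.range (leftRegular σ) := by
    rw [← Set.range_comp]; rfl
  have hmap := StarAlgHom.map_adjoin (toeplitz σ).subtype (Set.range (toeplitzGen σ))
  rw [himage] at hmap
  change (StarAlgebra.adjoin ℂ (Set.range (leftRegular σ)) : Set (EllTwo n →L[ℂ] EllTwo n)) ⊆ _
  rw [← hmap]
  exact subset_rfl

/-- The scalar and the new indices depend only on `σ`, not on `w`. This reduces words in the
generators to monomials, and later makes the limit map multiplicative. -/
theorem IsIsometricRep.star_mul_mul {B : Type*} [CStarAlgebra B] {w : (Fin n → ℕ) → B}
    (h : IsIsometricRep σ w) (hc : IsCovariant σ w) (r p q : Fin n → ℕ) :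
    star (w r) * (w p * star (w q)) =
      (star (σ r (r ⊔ p - r) : ℂ) * (σ p (r ⊔ p - p) : ℂ) * star (σ q (r ⊔ p - p) : ℂ)) •
        (w (r ⊔ p - r) * star (w (q + (r ⊔ p - p)))) := by
  rw [← mul_assoc, hc, h.apply_add q]
  simp only [star_smul, star_mul, star_star, mul_smul_comm, smul_mul_assoc, smul_smul, mul_assoc]
  rw [circle_star_mul_self, mul_one]

theorem mem_closure_generators (hσ : IsCocycle σ) {x : toeplitz σ}
    (hx : x ∈ Submonoid.closure
      (Set.range (toeplitzGen σ) ∪ star (Set.range (toeplitzGen σ)))) :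
    ∃ (c : ℂ) (p q : Fin n → ℕ), x = c • (toeplitzGen σ p * star (toeplitzGen σ q)) := by
  have h := isIsometricRep_toeplitzGen hσ
  have hc := isCovariant_toeplitzGen hσ
  induction hx using Submonoid.closure_induction_left with
  | one => exact ⟨1, 0, 0, by rw [one_smul]; exact h.rangeProj_zero.symm⟩
  | mul_left x hx y hy ih =>
    obtain ⟨c, p, q, rfl⟩ := ih
    rcases hx with ⟨r, rfl⟩ | ⟨r, hr⟩
    · exact ⟨c * σ r p, r + p, q, by
        rw [mul_smul_comm, ← mul_assoc, h.mul, smul_mul_assoc, smul_smul]⟩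
    · obtain rfl : star (toeplitzGen σ r) = x := by rw [hr, star_star]
      exact ⟨_, _, _, by rw [mul_smul_comm, h.star_mul_mul hc, smul_smul]⟩

theorem submodule_toeplitz_eq_top (hσ : IsCocycle σ) (K : Submodule ℂ (toeplitz σ))
    (hK : IsClosed (K : Set (toeplitz σ)))
    (hmem : ∀ p q, toeplitzGen σ p * star (toeplitzGen σ q) ∈ K) : K = ⊤ := by
  have hle : Subalgebra.toSubmodule
      (StarAlgebra.adjoin ℂ (Set.range (toeplitzGen σ))).toSubalgebra ≤ K := by
    rw [StarAlgebra.adjoin_eq_span, Submodule.span_le]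
    intro x hx
    obtain ⟨c, p, q, rfl⟩ := mem_closure_generators hσ hx
    exact K.smul_mem c (hmem p q)
  rw [eq_top_iff]
  rintro x -
  have hx : x ∈ cstarGen (Set.range (toeplitzGen σ)) := by
    rw [cstarGen_range_toeplitzGen]; trivial
  exact closure_minimal (s := (StarAlgebra.adjoin ℂ (Set.range (toeplitzGen σ)) :
    Set (toeplitz σ))) hle hK hx

theorem clm_toeplitz_ext (hσ : IsCocycle σ) {F : Type*} [NormedAddCommGroup F] [NormedSpace ℂ F]
    {f g : toeplitz σ →L[ℂ] F}
    (hfg : ∀ p q, f (toeplitzGen σ p * star (toeplitzGen σ q)) =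
      g (toeplitzGen σ p * star (toeplitzGen σ q))) : f = g := by
  have : LinearMap.eqLocus (f : toeplitz σ →ₗ[ℂ] F) (g : toeplitz σ →ₗ[ℂ] F) = ⊤ :=
    submodule_toeplitz_eq_top hσ _ (isClosed_eq f.continuous g.continuous) hfg
  ext x
  have hx : x ∈ LinearMap.eqLocus (f : toeplitz σ →ₗ[ℂ] F) (g : toeplitz σ →ₗ[ℂ] F) :=
    this ▸ Submodule.mem_top
  exact hx

end Density

/-! ### Existence and uniqueness of the homomorphism. -/

section UniversalProperty

variable {n : ℕ} {σ : (Fin n → ℕ) → (Fin n → ℕ) → Circle} {B : Type*} [CStarAlgebra B]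
  {w : (Fin n → ℕ) → B}

theorem exists_clm (hσ : IsCocycle σ) (h : IsIsometricRep σ w) (hn : IsNicaCovariant w) :
    ∃ f : toeplitz σ →L[ℂ] B, ∀ p q,
      f (toeplitzGen σ p * star (toeplitzGen σ q)) = w p * star (w q) := by
  obtain ⟨Φ, C, hC, hconv⟩ := exists_approx h hn
  let Ψ (k : ℕ) : toeplitz σ →ₗ[ℂ] B := (Φ k).comp (toeplitz σ).subtype.toAlgHom.toLinearMap
  have hΨ (k : ℕ) (x : toeplitz σ) : ‖Ψ k x‖ ≤ C * ‖x‖ := hC k x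
  have htop : convergenceSubmodule Ψ = ⊤ :=
    submodule_toeplitz_eq_top hσ _ (isClosed_convergenceSubmodule hΨ)
      fun p q => ⟨_, hconv p q⟩
  obtain ⟨f, hf⟩ := exists_limit hΨ htop
  exact ⟨f, fun p q => tendsto_nhds_unique (hf _) (hconv p q)⟩

theorem continuous_starAlgHom {A B : Type*} [CStarAlgebra A] [CStarAlgebra B]
    (ρ : A →⋆ₐ[ℂ] B) : Continuous ρ :=
  AddMonoidHomClass.continuous_of_bound ρ 1 fun a => by
    simpa using NonUnitalStarAlgHom.norm_apply_le ρ a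

theorem starAlgHom_toeplitz_ext {S : Set (toeplitz σ)} (hS : cstarGen S = ⊤)
    {ρ ρ' : toeplitz σ →⋆ₐ[ℂ] B} (hρ : ∀ x ∈ S, ρ x = ρ' x) : ρ = ρ' := by
  have := cstarGen_eq_top_iff.1 hS (StarAlgHom.equalizer ρ ρ')
    (isClosed_eq (continuous_starAlgHom ρ) (continuous_starAlgHom ρ')) hρ
  refine StarAlgHom.ext fun x => ?_
  have hx : x ∈ StarAlgHom.equalizer ρ ρ' := this ▸ trivial
  exact hx

theorem exists_starAlgHom (hσ : IsCocycle σ) (h : IsIsometricRep σ w) (hc : IsCovariant σ w) :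
    ∃ ρ : toeplitz σ →⋆ₐ[ℂ] B, ∀ p, ρ (toeplitzGen σ p) = w p := by
  obtain ⟨f, hf⟩ := exists_clm hσ h (h.isCovariant_iff.1 hc)
  have hL := isIsometricRep_toeplitzGen hσ
  have hLc := isCovariant_toeplitzGen hσ
  have hone : f 1 = 1 := by
    have h1 := hf 0 0
    rwa [show toeplitzGen σ 0 * star (toeplitzGen σ 0) = 1 from hL.rangeProj_zero,
      show w 0 * star (w 0) = 1 from h.rangeProj_zero] at h1
  have hstar (x : toeplitz σ) : f (star x) = star (f x) := by
    let s : toeplitz σ →L⋆[ℂ] toeplitz σ :=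
      ((starL ℂ : toeplitz σ ≃L⋆[ℂ] toeplitz σ) : toeplitz σ →L⋆[ℂ] toeplitz σ)
    let s' : B →L⋆[ℂ] B := ((starL ℂ : B ≃L⋆[ℂ] B) : B →L⋆[ℂ] B)
    have : s'.comp (f.comp s) = f := by
      refine clm_toeplitz_ext hσ fun p q => ?_
      change star (f (star _)) = _
      rw [star_mul, star_star, hf, hf, star_mul, star_star]
    have hx := congrArg (fun g : toeplitz σ →L[ℂ] B => g x) this
    change star (f (star x)) = f x at hx
    rw [← hx, star_star]
  -- The cocycle need not be normalised: the value at `0` is the scalar `σ 0 0`, the same in both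
  -- representations, and has to be cancelled.
  have hgen (p : Fin n → ℕ) : f (toeplitzGen σ p) = w p := by
    have h1 := hf p 0
    rw [hL.apply_zero, h.apply_zero] at h1
    simp only [star_smul, star_one, mul_smul_comm, mul_one, map_smul] at h1
    have h2 := congrArg ((σ 0 0 : ℂ) • ·) h1
    simpa only [smul_smul, circle_mul_star_self, one_smul] using h2
  have hmulgen (r : Fin n → ℕ) (y : toeplitz σ) :
      f (toeplitzGen σ r * y) = w r * f y := by
    have : f.comp (ContinuousLinearMap.mul ℂ (toeplitz σ) (toeplitzGen σ r)) =
        (ContinuousLinearMap.mul ℂ B (w r)).comp f := by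
      refine clm_toeplitz_ext hσ fun p q => ?_
      change f (_ * _) = w r * f _
      rw [← mul_assoc, hL.mul, smul_mul_assoc, map_smul, hf, hf, ← mul_assoc, h.mul,
        smul_mul_assoc]
    exact congrArg (fun g : toeplitz σ →L[ℂ] B => g y) this
  have hmulstar (r : Fin n → ℕ) (y : toeplitz σ) :
      f (star (toeplitzGen σ r) * y) = star (w r) * f y := by
    have : f.comp (ContinuousLinearMap.mul ℂ (toeplitz σ) (star (toeplitzGen σ r))) =
        (ContinuousLinearMap.mul ℂ B (star (w r))).comp f := by
      refine clm_toeplitz_ext hσ fun p q => ?_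
      change f (_ * _) = star (w r) * f _
      rw [hL.star_mul_mul hLc, map_smul, hf, hf, h.star_mul_mul hc]
    exact congrArg (fun g : toeplitz σ →L[ℂ] B => g y) this
  -- For fixed `y` both sides are continuous and linear in `x`, so `x` may be a monomial, whose two
  -- factors are peeled off by `hmulgen` and `hmulstar`.
  have hmul (x y : toeplitz σ) : f (x * y) = f x * f y := by
    have : f.comp ((ContinuousLinearMap.mul ℂ (toeplitz σ)).flip y) =
        ((ContinuousLinearMap.mul ℂ B).flip (f y)).comp f := by
      refine clm_toeplitz_ext hσ fun p q => ?_
      change f (_ * _) = f _ * f y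
      rw [mul_assoc, hmulgen, hmulstar, hf, mul_assoc]
    exact congrArg (fun g : toeplitz σ →L[ℂ] B => g x) this
  exact ⟨{ toFun := f
           map_one' := hone
           map_mul' := hmul
           map_zero' := map_zero f
           map_add' := map_add f
           commutes' := fun c => by
            rw [Algebra.algebraMap_eq_smul_one, map_smul, hone, Algebra.algebraMap_eq_smul_one]
           map_star' := hstar }, hgen⟩

end UniversalProperty

/-! ### The rank-one defect projection and faithfulness. -/

section Injectivity

variable {n : ℕ} {σ : (Fin n → ℕ) → (Fin n → ℕ) → Circle} {B : Type*} [CStarAlgebra B]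

theorem map_defectProd {A B : Type*} [CStarAlgebra A] [CStarAlgebra B] (ρ : A →⋆ₐ[ℂ] B)
    (w : Fin n → A) : ρ (defectProd w) = defectProd fun j => ρ (w j) := by
  simp only [defectProd, map_list_prod, List.map_ofFn]
  congr 2
  ext j
  simp only [Function.comp_apply, map_sub, map_one, map_mul, map_star]

theorem gen_le_iff {j : Fin n} {s : Fin n → ℕ} : gen j ≤ s ↔ s j ≠ 0 := by
  rw [← Nat.one_le_iff_ne_zero]
  constructor
  · intro h
    simpa [gen] using h j
  · intro h i
    by_cases hi : i = j
    · subst hi; simpa [gen] using h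
    · simp [gen, hi]

theorem defectProd_leftRegular_delta (s : Fin n → ℕ) :
    defectProd (fun j => leftRegular σ (gen j)) (delta s) = if s = 0 then delta s else 0 := by
  classical
  have key (l : List (Fin n)) :
      (l.map fun j => 1 - leftRegular σ (gen j) * star (leftRegular σ (gen j))).prod (delta s) =
        if ∀ j ∈ l, s j = 0 then delta s else 0 := by
    induction l with
    | nil => simp
    | cons k l ih =>
      have hcons : (∀ j ∈ k :: l, s j = 0) ↔ s k = 0 ∧ ∀ j ∈ l, s j = 0 := List.forall_mem_cons
      rw [List.map_cons, List.prod_cons, mul_apply_eq_comp, ih]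
      by_cases hl : ∀ j ∈ l, s j = 0
      · rw [if_pos hl, sub_apply, leftRegular_rangeProj_delta, one_apply_eq_self]
        by_cases hk : s k = 0
        · rw [if_neg (by simpa [gen_le_iff] using hk), sub_zero,
            if_pos (hcons.2 ⟨hk, hl⟩)]
        · rw [if_pos (gen_le_iff.2 hk), sub_self,
            if_neg fun h => hk (hcons.1 h).1]
      · rw [if_neg hl, map_zero, if_neg fun h => hl (hcons.1 h).2]
  rw [defectProd, List.ofFn_eq_map, key]
  simp [funext_iff]

/-- The defect product fixes `δ_0` and kills every other `δ_s`; being self-adjoint, it is the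
rank-one projection onto `δ_0`. -/
theorem defectProd_mul_mul_defectProd (X : EllTwo n →L[ℂ] EllTwo n) :
    defectProd (fun j => leftRegular σ (gen j)) * X * defectProd (fun j => leftRegular σ (gen j)) =
      (inner ℂ (delta 0) (X (delta 0)) : ℂ) • defectProd (fun j => leftRegular σ (gen j)) := by
  set P := defectProd (fun j => leftRegular σ (gen j)) with hP
  have hPd (s : Fin n → ℕ) : P (delta s) = if s = 0 then delta s else 0 :=
    defectProd_leftRegular_delta s
  have hinner (s t : Fin n → ℕ) :
      inner ℂ (P (delta s)) (delta t : EllTwo n) = inner ℂ (delta s) (P (delta t)) := by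
    rw [hPd, hPd]
    by_cases hs : s = 0 <;> by_cases ht : t = 0 <;>
      simp [hs, ht, inner_delta_delta, Ne.symm]
  have hself : star P = P := by
    refine clm_ext_delta fun t => ellTwo_ext fun s => ?_
    rw [ContinuousLinearMap.star_eq_adjoint, ContinuousLinearMap.adjoint_inner_right, hinner]
  have hrank (f : EllTwo n) : P f = (inner ℂ (delta 0) f : ℂ) • delta 0 := by
    refine ellTwo_ext fun t => ?_
    conv_lhs => rw [← hself]
    rw [ContinuousLinearMap.star_eq_adjoint, ContinuousLinearMap.adjoint_inner_right, hPd,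
      inner_smul_right, inner_delta_delta]
    by_cases ht : t = 0 <;> simp [ht]
  refine clm_ext_delta fun s => ?_
  rw [mul_apply_eq_comp, mul_apply_eq_comp, smul_apply, hPd]
  by_cases hs : s = 0
  · rw [if_pos hs, hs, hrank]
  · rw [if_neg hs, map_zero, map_zero, smul_zero]

theorem coe_defectProd_toeplitzGen :
    ((defectProd fun j => toeplitzGen σ (gen j) : toeplitz σ) : EllTwo n →L[ℂ] EllTwo n) =
      defectProd fun j => leftRegular σ (gen j) :=
  map_defectProd (toeplitz σ).subtype _

theorem delta_ne_zero (q : Fin n → ℕ) : (delta q : EllTwo n) ≠ 0 := by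
  intro h
  have := inner_delta_delta q q
  simp [h] at this

theorem injective_iff_defectProd_ne_zero (ρ : toeplitz σ →⋆ₐ[ℂ] B) :
    Function.Injective ρ ↔ defectProd (fun j => ρ (toeplitzGen σ (gen j))) ≠ 0 := by
  rw [← map_defectProd ρ (fun j => toeplitzGen σ (gen j))]
  constructor
  · intro hinj h0
    have h1 := congrArg Subtype.val ((map_eq_zero_iff ρ hinj).1 h0)
    rw [coe_defectProd_toeplitzGen] at h1
    have h2 := defectProd_leftRegular_delta (σ := σ) 0
    rw [h1, if_pos rfl] at h2
    exact delta_ne_zero 0 h2.symm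
  · intro hne
    -- For `a` in the kernel, compress `(a L_r)* (a L_r)` by the defect projection `P`: the result
    -- is `‖a L_r δ_0‖² P`. Applying `ρ`, with `ρ P ≠ 0`, forces `a L_r δ_0 = 0`, and `L_r δ_0` is a
    -- unimodular multiple of `δ_r`.
    refine (injective_iff_map_eq_zero ρ).2 fun a ha => Subtype.ext (clm_ext_delta fun r => ?_)
    set v := (a : EllTwo n →L[ℂ] EllTwo n) (leftRegular σ r (delta 0)) with hv
    set P : toeplitz σ := defectProd fun j => toeplitzGen σ (gen j)
    set X : toeplitz σ := star (a * toeplitzGen σ r) * (a * toeplitzGen σ r)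
    have hX : (inner ℂ (delta 0) ((X : EllTwo n →L[ℂ] EllTwo n) (delta 0)) : ℂ) =
        inner ℂ v v := by
      change inner ℂ (delta 0) ((star ((a : EllTwo n →L[ℂ] EllTwo n) * leftRegular σ r) *
        ((a : EllTwo n →L[ℂ] EllTwo n) * leftRegular σ r)) (delta 0)) = _
      rw [mul_apply_eq_comp, ContinuousLinearMap.star_eq_adjoint,
        ContinuousLinearMap.adjoint_inner_right]
      rfl
    have hPXP : P * X * P = (inner ℂ v v : ℂ) • P := by
      refine Subtype.ext ?_
      change (P : EllTwo n →L[ℂ] EllTwo n) * X * P = (inner ℂ v v : ℂ) • (P : _)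
      rw [coe_defectProd_toeplitzGen, defectProd_mul_mul_defectProd, hX]
    have h0 := congrArg ρ hPXP
    simp only [map_smul, map_mul, map_star, X, ha, zero_mul, mul_zero] at h0
    have hvv := (smul_eq_zero.1 h0.symm).resolve_right hne
    have hv0 : v = 0 := inner_self_eq_zero.1 hvv
    rw [hv, leftRegular_delta, map_smul, add_zero] at hv0
    exact (smul_eq_zero.1 hv0).resolve_left (Circle.coe_ne_zero _)

end Injectivity

/-! ### The bicharacter of `Θ`. -/

section Bicharacter

variable {n : ℕ} (Θ : Matrix (Fin n) (Fin n) ℝ)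

theorem bichar_eq (p q : Fin n → ℕ) :
    bichar Θ p q = Circle.exp (-(Real.pi * ∑ i, ∑ k, (p i : ℝ) * Θ i k * q k)) := by
  simp only [bichar, dotProduct, Matrix.mulVec, Finset.mul_sum, mul_assoc]

theorem bichar_add_left (p p' q : Fin n → ℕ) :
    bichar Θ (p + p') q = bichar Θ p q * bichar Θ p' q := by
  simp only [bichar_eq, ← Circle.exp_add, Pi.add_apply, Nat.cast_add, add_mul,
    Finset.sum_add_distrib]
  ring_nf

theorem bichar_add_right (p q q' : Fin n → ℕ) :
    bichar Θ p (q + q') = bichar Θ p q * bichar Θ p q' := by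
  simp only [bichar_eq, ← Circle.exp_add, Pi.add_apply, Nat.cast_add, mul_add,
    Finset.sum_add_distrib]
  ring_nf

theorem bichar_zero_left (q : Fin n → ℕ) : bichar Θ 0 q = 1 := by simp [bichar_eq]

theorem isCocycle_bichar : IsCocycle (bichar Θ) := by
  intro p q r
  rw [bichar_add_left, bichar_add_right]
  ac_rfl

theorem bichar_gen_left (j : Fin n) (q : Fin n → ℕ) :
    bichar Θ (gen j) q = Circle.exp (-(Real.pi * ∑ k, Θ j k * q k)) := by
  rw [bichar_eq]
  congr 3
  rw [Finset.sum_eq_single j]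
  · simp [gen]
  · intro i _ hi; simp [gen, hi]
  · simp

theorem bichar_gen_right (p : Fin n → ℕ) (k : Fin n) :
    bichar Θ p (gen k) = Circle.exp (-(Real.pi * ∑ i, p i * Θ i k)) := by
  rw [bichar_eq]
  congr 3
  refine Finset.sum_congr rfl fun i _ => ?_
  rw [Finset.sum_eq_single k]
  · simp [gen]
  · intro i _ hi; simp [gen, hi]
  · simp

theorem bichar_gen_gen (j k : Fin n) :
    bichar Θ (gen j) (gen k) = Circle.exp (-(Real.pi * Θ j k)) := by
  rw [bichar_gen_left, Finset.sum_eq_single k]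
  · simp [gen]
  · intro i _ hi; simp [gen, hi]
  · simp

theorem coe_bichar_gen_gen (j k : Fin n) :
    (bichar Θ (gen j) (gen k) : ℂ) = Complex.exp (-(Real.pi * Complex.I * Θ j k)) := by
  rw [bichar_gen_gen, Circle.coe_exp]
  congr 1
  push_cast
  ring

theorem star_coe_bichar_gen_gen (j k : Fin n) :
    star (bichar Θ (gen j) (gen k) : ℂ) = Complex.exp (Real.pi * Complex.I * Θ j k) := by
  have h := circle_star_mul_self (bichar Θ (gen j) (gen k))
  rw [coe_bichar_gen_gen] at h ⊢
  refine mul_right_cancel₀ (Complex.exp_ne_zero (-(Real.pi * Complex.I * Θ j k))) ?_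
  rw [h, ← Complex.exp_add]
  simp

end Bicharacter

/-! ### Families of isometries attached to `Θ` and their ordered words. -/

section Family

variable {n : ℕ} {Θ : Matrix (Fin n) (Fin n) ℝ} {B : Type*} [CStarAlgebra B]

theorem antisymm_apply (hΘ : Θᵀ = -Θ) (j k : Fin n) : Θ k j = -Θ j k := by
  have := congrFun (congrFun hΘ j) k
  simpa using this

theorem gen_induction {P : (Fin n → ℕ) → Prop} (h0 : P 0) (hadd : ∀ j p, P p → P (gen j + p))
    (p : Fin n → ℕ) : P p := by
  induction hm : ∑ j, p j generalizing p with
  | zero =>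
    have : p = 0 := by
      ext j
      exact (Finset.sum_eq_zero_iff.1 hm) j (Finset.mem_univ j)
    rwa [this]
  | succ m ih =>
    obtain ⟨j, hj⟩ : ∃ j, p j ≠ 0 := by
      by_contra! hcon
      simp [hcon] at hm
    have hp : gen j + (p - gen j) = p := add_tsub_cancel_of_le (gen_le_iff.2 hj)
    rw [← hp]
    refine hadd j _ (ih _ ?_)
    rw [← hp] at hm
    simp only [Pi.add_apply, Finset.sum_add_distrib] at hm
    have : ∑ i, gen j i = 1 := by simp [gen]
    omega

theorem gen_sup_gen_sub {j k : Fin n} (h : j ≠ k) : gen j ⊔ gen k - gen j = gen k := by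
  ext i
  by_cases hi : i = j
  · subst hi; simp [gen, h]
  · simp [gen, hi]

theorem IsIsometricRep.isToeplitzFamily (hΘ : Θᵀ = -Θ) {W : (Fin n → ℕ) → B}
    (h : IsIsometricRep (bichar Θ) W) (hc : IsCovariant (bichar Θ) W) :
    IsToeplitzFamily Θ fun j => W (gen j) where
  isometry j := h.isometry _
  comm j k := by
    rw [h.mul, h.mul, smul_smul, add_comm (gen k), coe_bichar_gen_gen, coe_bichar_gen_gen,
      antisymm_apply hΘ j k, ← Complex.exp_add]
    congr 2
    push_cast
    ring
  star_comm j k hjk := by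
    rw [hc, gen_sup_gen_sub hjk, sup_comm, gen_sup_gen_sub hjk.symm, star_coe_bichar_gen_gen,
      coe_bichar_gen_gen, antisymm_apply hΘ j k, ← Complex.exp_add]
    congr 2
    push_cast
    ring

theorem IsIsometricRep.ext_gen {W W' : (Fin n → ℕ) → B} (h : IsIsometricRep (bichar Θ) W)
    (h' : IsIsometricRep (bichar Θ) W') (hg : ∀ j, W (gen j) = W' (gen j)) : W = W' := by
  ext p
  induction p using gen_induction with
  | h0 => rw [h.apply_zero, h'.apply_zero]
  | hadd j p ih => rw [h.apply_add, h'.apply_add, hg, ih]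

theorem pow_mul_eq_smul {x y : B} {c : ℂ} (h : x * y = c • (y * x)) (a : ℕ) :
    x ^ a * y = c ^ a • (y * x ^ a) := by
  induction a with
  | zero => simp
  | succ a ih =>
    rw [pow_succ', mul_assoc, ih, mul_smul_comm, ← mul_assoc, h, smul_mul_assoc, smul_smul,
      mul_assoc, pow_succ]

theorem mul_pow_eq_smul {x y : B} {c : ℂ} (h : x * y = c • (y * x)) (a : ℕ) :
    x * y ^ a = c ^ a • (y ^ a * x) := by
  induction a with
  | zero => simp
  | succ a ih =>
    rw [pow_succ, ← mul_assoc, ih, smul_mul_assoc, mul_assoc, h, mul_smul_comm, smul_smul,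
      mul_assoc, pow_succ]

namespace IsToeplitzFamily

variable {w : Fin n → B}

theorem isometry_pow (h : IsToeplitzFamily Θ w) (j : Fin n) (a : ℕ) :
    star (w j ^ a) * w j ^ a = 1 := by
  induction a with
  | zero => simp
  | succ a ih =>
    rw [pow_succ', star_mul, mul_assoc, ← mul_assoc (star (w j)), h.isometry, one_mul, ih]

theorem isometry_list (h : IsToeplitzFamily Θ w) (q : Fin n → ℕ) (l : List (Fin n)) :
    star (l.map fun j => w j ^ q j).prod * (l.map fun j => w j ^ q j).prod = 1 := by
  induction l with
  | nil => simp
  | cons k l ih =>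
    rw [List.map_cons, List.prod_cons, star_mul, mul_assoc, ← mul_assoc (star (w k ^ q k)),
      h.isometry_pow, one_mul, ih]

/-- Moving `star (w j)` and `w j` past `w k` costs mutually inverse phases. -/
theorem commute_range_pow (h : IsToeplitzFamily Θ w) {j k : Fin n} (hjk : j ≠ k) (a b : ℕ) :
    Commute (w j ^ a * star (w j ^ a)) (w k ^ b) := by
  refine Commute.pow_right ?_ b
  have h1 := pow_mul_eq_smul (h.comm j k) a
  have h2 := pow_mul_eq_smul (h.star_comm j k hjk) a
  rw [Commute, SemiconjBy, star_pow, mul_assoc, h2, mul_smul_comm, ← mul_assoc, h1, smul_mul_assoc,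
    smul_smul, ← mul_pow, ← Complex.exp_add]
  simp [mul_assoc]

theorem commute_range_range (h : IsToeplitzFamily Θ w) {j k : Fin n} (hjk : j ≠ k) (a b : ℕ) :
    Commute (w j ^ a * star (w j ^ a)) (w k ^ b * star (w k ^ b)) := by
  have h1 := h.commute_range_pow hjk a b
  have h2 := h1.star_star
  rw [star_mul, star_star] at h2
  exact h1.mul_right h2

theorem range_mul_range (h : IsToeplitzFamily Θ w) (j : Fin n) (a b : ℕ) :
    w j ^ a * star (w j ^ a) * (w j ^ b * star (w j ^ b)) =
      w j ^ max a b * star (w j ^ max a b) := by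
  have key {a b : ℕ} (hab : a ≤ b) : w j ^ a * star (w j ^ a) * (w j ^ b * star (w j ^ b)) =
      w j ^ b * star (w j ^ b) := by
    obtain ⟨c, rfl⟩ := Nat.exists_eq_add_of_le hab
    have : w j ^ a * star (w j ^ a) * w j ^ (a + c) = w j ^ (a + c) := by
      rw [pow_add, mul_assoc, ← mul_assoc (star (w j ^ a)), h.isometry_pow, one_mul]
    rw [← mul_assoc, this]
  rcases le_total a b with hab | hab
  · rw [max_eq_right hab, key hab]
  · have := congrArg star (key hab)
    simp only [star_mul, star_star] at this
    rw [max_eq_left hab, this]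

theorem range_list (h : IsToeplitzFamily Θ w) (q : Fin n → ℕ) {l : List (Fin n)} (hl : l.Nodup) :
    (l.map fun j => w j ^ q j).prod * star (l.map fun j => w j ^ q j).prod =
      (l.map fun j => w j ^ q j * star (w j ^ q j)).prod := by
  induction l with
  | nil => simp
  | cons k l ih =>
    obtain ⟨hk, hl⟩ := List.nodup_cons.1 hl
    have hcomm : Commute (w k ^ q k) (l.map fun j => w j ^ q j * star (w j ^ q j)).prod := by
      refine Commute.list_prod_right _ _ fun x hx => ?_
      obtain ⟨j, hj, rfl⟩ := List.mem_map.1 hx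
      exact (h.commute_range_pow (by rintro rfl; exact hk hj) _ _).symm
    rw [List.map_cons, List.prod_cons, star_mul, List.map_cons, List.prod_cons, mul_assoc,
      ← mul_assoc _ (star _) (star (w k ^ q k)), ih hl, ← mul_assoc, hcomm.eq, mul_assoc]
    refine (Commute.list_prod_left _ _ fun x hx => ?_).eq
    obtain ⟨j, hj, rfl⟩ := List.mem_map.1 hx
    exact h.commute_range_range (by rintro rfl; exact hk hj) _ _

theorem range_list_mul (h : IsToeplitzFamily Θ w) (p q : Fin n → ℕ) {l : List (Fin n)}
    (hl : l.Nodup) :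
    (l.map fun j => w j ^ p j * star (w j ^ p j)).prod *
        (l.map fun j => w j ^ q j * star (w j ^ q j)).prod =
      (l.map fun j => w j ^ (p ⊔ q) j * star (w j ^ (p ⊔ q) j)).prod := by
  induction l with
  | nil => simp
  | cons k l ih =>
    obtain ⟨hk, hl⟩ := List.nodup_cons.1 hl
    have hcomm : Commute (l.map fun j => w j ^ p j * star (w j ^ p j)).prod
        (w k ^ q k * star (w k ^ q k)) := by
      refine Commute.list_prod_left _ _ fun x hx => ?_
      obtain ⟨j, hj, rfl⟩ := List.mem_map.1 hx
      exact h.commute_range_range (by rintro rfl; exact hk hj) _ _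
    simp only [List.map_cons, List.prod_cons]
    rw [hcomm.mul_mul_mul_comm, h.range_mul_range, ih hl]
    rfl

/-- `w j` travels right until it meets its own power. The list is sorted, so it crosses exactly the
factors with `k < j`. -/
theorem mul_list (h : IsToeplitzFamily Θ w) (q : Fin n → ℕ) (j : Fin n) {l : List (Fin n)}
    (hl : l.Pairwise (· < ·)) (hj : j ∈ l) :
    w j * (l.map fun k => w k ^ q k).prod =
      (l.map fun k => if k < j then
        Complex.exp (-(2 * Real.pi * Complex.I * Θ j k)) ^ q k else 1).prod •
        (l.map fun k => w k ^ (gen j + q) k).prod := by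
  induction l with
  | nil => simp at hj
  | cons k l ih =>
    obtain ⟨hk, hl⟩ := List.pairwise_cons.1 hl
    simp only [List.map_cons, List.prod_cons]
    by_cases hjk : j = k
    · subst hjk
      have h1 : (l.map fun k => if k < j then
          Complex.exp (-(2 * Real.pi * Complex.I * Θ j k)) ^ q k else 1) =
          l.map fun _ => (1 : ℂ) :=
        List.map_congr_left fun i hi => if_neg (hk i hi).not_gt
      have h2 : (l.map fun k => w k ^ (gen j + q) k) = l.map fun k => w k ^ q k :=
        List.map_congr_left fun i hi => by simp [gen, (hk i hi).ne']
      rw [h1, h2]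
      simp [gen, pow_add, mul_assoc]
    · have hjl : j ∈ l := (List.mem_cons.1 hj).resolve_left hjk
      rw [if_pos (hk j hjl), ← mul_assoc, mul_pow_eq_smul (h.comm j k), smul_mul_assoc,
        mul_assoc (w k ^ q k) (w j), ih hl hjl, mul_smul_comm, smul_smul]
      congr 3
      simp [gen, Ne.symm hjk]

end IsToeplitzFamily

theorem sub_sum_Iic (q : Fin n → ℕ) (j : Fin n) :
    q - ∑ i ∈ Finset.Iic j, q i • gen i = fun m => if j < m then q m else 0 := by
  ext m
  rw [Pi.sub_apply, Finset.sum_apply]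
  have : ∑ i ∈ Finset.Iic j, (q i • gen i) m = if m ≤ j then q m else 0 := by
    simp only [gen, Pi.smul_apply, Pi.single_apply, smul_eq_mul, mul_ite, mul_one, mul_zero,
      Finset.sum_ite_eq, Finset.mem_Iic]
  rw [this]
  by_cases hm : m ≤ j
  · simp [hm]
  · simp [hm]

theorem circle_exp_sum {ι : Type*} (s : Finset ι) (f : ι → ℝ) :
    Circle.exp (∑ i ∈ s, f i) = ∏ i ∈ s, Circle.exp (f i) := by
  classical
  induction s using Finset.induction_on with
  | empty => simp
  | insert i s hi ih => rw [Finset.sum_insert hi, Finset.prod_insert hi, Circle.exp_add, ih]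

theorem coe_prod_pow {ι : Type*} (s : Finset ι) (f : ι → Circle) (a : ι → ℕ) :
    ((∏ i ∈ s, f i ^ a i : Circle) : ℂ) = ∏ i ∈ s, (f i : ℂ) ^ a i := by
  classical
  induction s using Finset.induction_on with
  | empty => simp
  | insert i s hi ih =>
    rw [Finset.prod_insert hi, Finset.prod_insert hi, Circle.coe_mul, Circle.coe_pow, ih]

theorem prod_bichar_eq (Θ : Matrix (Fin n) (Fin n) ℝ) (q : Fin n → ℕ) :
    ∏ j : Fin n, bichar Θ (q - ∑ i ∈ Finset.Iic j, q i • gen i) (gen j) ^ q j =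
      Circle.exp (-(Real.pi * ∑ j, ∑ m, if j < m then (q j : ℝ) * q m * Θ m j else 0)) := by
  rw [Finset.mul_sum, ← Finset.sum_neg_distrib, circle_exp_sum]
  refine Finset.prod_congr rfl fun j _ => ?_
  rw [sub_sum_Iic, bichar_gen_right, ← Circle.exp_nsmul, nsmul_eq_mul, mul_neg, mul_left_comm,
    Finset.mul_sum]
  congr 3
  refine Finset.sum_congr rfl fun m _ => ?_
  split_ifs <;> simp [mul_assoc]

/-- This is the phase balance of `mul_orderedWord`: the quadratic form records the ordered word's
phase, the linear sum is the cocycle, and the doubled sum is the cost of reordering. By antisymmetry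
the terms with `k > j` cancel, those with `k < j` double, and the diagonal one vanishes. -/
theorem sum_quadratic_gen_add (hΘ : Θᵀ = -Θ) (q : Fin n → ℕ) (j : Fin n) :
    (∑ i, ∑ m, if i < m then ((gen j + q) i : ℝ) * (gen j + q) m * Θ m i else 0) +
        ∑ k, Θ j k * q k =
      (∑ i, ∑ m, if i < m then (q i : ℝ) * q m * Θ m i else 0) +
        ∑ k, if k < j then 2 * Θ j k * q k else 0 := by
  -- The product of the two increments never contributes, since `i < m` excludes `i = m = j`.
  have hterm (i m : Fin n) :
      (if i < m then ((gen j + q) i : ℝ) * (gen j + q) m * Θ m i else 0) =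
        (if i < m then (q i : ℝ) * q m * Θ m i else 0) +
          (if i = j then (if j < m then q m * Θ m j else 0) else 0) +
          (if m = j then (if i < j then q i * Θ j i else 0) else 0) := by
    by_cases him : i < m
    · by_cases hi : i = j
      · subst hi
        simp [him, gen, him.ne']
        ring
      · by_cases hm : m = j
        · subst hm
          simp [him, gen, him.ne]
          ring
        · simp [him, gen, hi, hm]
    · rw [if_neg him, if_neg him]
      by_cases hi : i = j
      · subst hi
        by_cases hm : m = i
        · simp [hm]
        · simp [him, hm]
      · by_cases hm : m = j
        · subst hm
          simp [him, hi]
        · simp [hi, hm]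
  simp only [hterm, Finset.sum_add_distrib, Finset.sum_ite_eq', Finset.mem_univ, if_true]
  have hcomm : ∑ i, ∑ m, (if i = j then (if j < m then q m * Θ m j else 0) else 0) =
      ∑ m, if j < m then q m * Θ m j else 0 := by
    rw [Finset.sum_comm]
    simp
  rw [hcomm, add_assoc, add_assoc, ← Finset.sum_add_distrib, ← Finset.sum_add_distrib]
  congr 1
  refine Finset.sum_congr rfl fun k _ => ?_
  have hdiag : Θ j j = 0 := by
    have := antisymm_apply hΘ j j
    linarith
  rcases lt_trichotomy k j with hk | hk | hk
  · simp [hk, hk.not_gt]; ring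
  · subst hk; simp [hdiag]
  · simp [hk, hk.not_gt, antisymm_apply hΘ j k]; ring

theorem orderedWord_eq (Θ : Matrix (Fin n) (Fin n) ℝ) (w : Fin n → B) (q : Fin n → ℕ) :
    orderedWord Θ w q =
      (Circle.exp (-(Real.pi * ∑ j, ∑ m, if j < m then (q j : ℝ) * q m * Θ m j else 0)) : ℂ) •
        ((List.finRange n).map fun j => w j ^ q j).prod := by
  rw [orderedWord, List.ofFn_eq_map, ← prod_bichar_eq]
  congr 1
  exact (coe_prod_pow _ _ _).symm

namespace IsToeplitzFamily

variable {w : Fin n → B}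

theorem mul_orderedWord (hΘ : Θᵀ = -Θ) (h : IsToeplitzFamily Θ w) (j : Fin n) (q : Fin n → ℕ) :
    w j * orderedWord Θ w q = (bichar Θ (gen j) q : ℂ) • orderedWord Θ w (gen j + q) := by
  have hscal : ((List.finRange n).map fun k => if k < j then
      Complex.exp (-(2 * Real.pi * Complex.I * Θ j k)) ^ q k else 1).prod =
      (Circle.exp (-(Real.pi * ∑ k, if k < j then 2 * Θ j k * q k else 0)) : ℂ) := by
    rw [← List.ofFn_eq_map, List.prod_ofFn, Circle.coe_exp]
    push_cast
    rw [Finset.mul_sum, ← Finset.sum_neg_distrib, Finset.sum_mul, Complex.exp_sum]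
    refine Finset.prod_congr rfl fun k _ => ?_
    split_ifs
    · rw [← Complex.exp_nat_mul]
      congr 1
      push_cast
      ring
    · simp
  rw [orderedWord_eq, orderedWord_eq, mul_smul_comm, h.mul_list q j (List.pairwise_lt_finRange n)
    (List.mem_finRange j), hscal, smul_smul, smul_smul, bichar_gen_left, ← Circle.coe_mul,
    ← Circle.coe_mul, ← Circle.exp_add, ← Circle.exp_add]
  congr 3
  have := sum_quadratic_gen_add hΘ q j
  linear_combination Real.pi * this

theorem orderedWord_zero (w : Fin n → B) : orderedWord Θ w 0 = 1 := by
  rw [orderedWord_eq]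
  simp

theorem orderedWord_gen (hΘ : Θᵀ = -Θ) (h : IsToeplitzFamily Θ w) (j : Fin n) :
    orderedWord Θ w (gen j) = w j := by
  have := h.mul_orderedWord hΘ j 0
  rw [orderedWord_zero, mul_one, add_zero, bichar_gen_left] at this
  simpa using this.symm

/-- Multiplicativity follows from the case of a generator on the left, `mul_orderedWord`, by
induction on `p`, because `bichar Θ` is additive in each variable. -/
theorem isIsometricRep_orderedWord (hΘ : Θᵀ = -Θ) (h : IsToeplitzFamily Θ w) :
    IsIsometricRep (bichar Θ) (orderedWord Θ w) where
  isometry p := by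
    rw [orderedWord_eq, star_smul, smul_mul_smul_comm, circle_star_mul_self, one_smul,
      h.isometry_list]
  mul p q := by
    induction p using gen_induction with
    | h0 => rw [orderedWord_zero, one_mul, zero_add, bichar_zero_left, Circle.coe_one, one_smul]
    | hadd j p ih =>
      have hword : orderedWord Θ w (gen j + p) =
          star (bichar Θ (gen j) p : ℂ) • (w j * orderedWord Θ w p) := by
        rw [h.mul_orderedWord hΘ, smul_smul, circle_star_mul_self, one_smul]
      rw [hword, smul_mul_assoc, mul_assoc, ih, mul_smul_comm, h.mul_orderedWord hΘ, smul_smul,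
        smul_smul, add_assoc]
      congr 1
      rw [bichar_add_left, bichar_add_right, Circle.coe_mul, Circle.coe_mul]
      linear_combination ((bichar Θ p q : ℂ) * bichar Θ (gen j) q) *
        circle_star_mul_self (bichar Θ (gen j) p)

/-- The range projection of an ordered word is the product of those of the powers `w j ^ p j`. These
commute for different `j`, and for the same `j` they multiply by taking the larger exponent. -/
theorem isNicaCovariant_orderedWord (h : IsToeplitzFamily Θ w) :
    IsNicaCovariant (orderedWord Θ w) := by
  have hrange (p : Fin n → ℕ) : orderedWord Θ w p * star (orderedWord Θ w p) =
      ((List.finRange n).map fun j => w j ^ p j * star (w j ^ p j)).prod := by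
    rw [orderedWord_eq, star_smul, smul_mul_smul_comm, circle_mul_star_self, one_smul,
      h.range_list p (List.nodup_finRange n)]
  intro p q
  rw [hrange, hrange, hrange, h.range_list_mul p q (List.nodup_finRange n)]

theorem isCovariant_orderedWord (hΘ : Θᵀ = -Θ) (h : IsToeplitzFamily Θ w) :
    IsCovariant (bichar Θ) (orderedWord Θ w) :=
  (h.isIsometricRep_orderedWord hΘ).isCovariant_iff.2 h.isNicaCovariant_orderedWord

end IsToeplitzFamily

theorem isToeplitzFamily_iff (hΘ : Θᵀ = -Θ) (w : Fin n → B) :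
    IsToeplitzFamily Θ w ↔ ∃! W : (Fin n → ℕ) → B,
      IsIsometricRep (bichar Θ) W ∧ IsCovariant (bichar Θ) W ∧ ∀ j, W (gen j) = w j := by
  constructor
  · intro h
    refine ⟨orderedWord Θ w, ⟨h.isIsometricRep_orderedWord hΘ, h.isCovariant_orderedWord hΘ,
      h.orderedWord_gen hΘ⟩, fun W hW => ?_⟩
    exact hW.1.ext_gen (h.isIsometricRep_orderedWord hΘ) fun j => by
      rw [hW.2.2, h.orderedWord_gen hΘ]
  · rintro ⟨W, ⟨hW, hWc, hWg⟩, -⟩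
    obtain rfl : (fun j => W (gen j)) = w := funext hWg
    exact hW.isToeplitzFamily hΘ hWc

theorem isToeplitzFamily_toeplitzGen (hΘ : Θᵀ = -Θ) :
    IsToeplitzFamily Θ fun j => toeplitzGen (bichar Θ) (gen j) :=
  (isIsometricRep_toeplitzGen (isCocycle_bichar Θ)).isToeplitzFamily hΘ
    (isCovariant_toeplitzGen (isCocycle_bichar Θ))

theorem IsIsometricRep.mem_starSubalgebra {W : (Fin n → ℕ) → B}
    (h : IsIsometricRep (bichar Θ) W) {T : StarSubalgebra ℂ B} (hT : ∀ j, W (gen j) ∈ T)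
    (p : Fin n → ℕ) : W p ∈ T := by
  induction p using gen_induction with
  | h0 =>
    rw [h.apply_zero]
    exact T.smul_mem T.one_mem _
  | hadd j p ih =>
    rw [h.apply_add]
    exact T.smul_mem (T.mul_mem (hT j) ih) _

theorem cstarGen_range_toeplitzGen_gen (Θ : Matrix (Fin n) (Fin n) ℝ) :
    cstarGen (Set.range fun j : Fin n => toeplitzGen (bichar Θ) (gen j)) = ⊤ := by
  refine cstarGen_eq_top_iff.2 fun T hT hS => ?_
  refine cstarGen_eq_top_iff.1 (cstarGen_range_toeplitzGen (bichar Θ)) T hT ?_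
  rintro _ ⟨p, rfl⟩
  exact (isIsometricRep_toeplitzGen (isCocycle_bichar Θ)).mem_starSubalgebra
    (fun j => hS ⟨j, rfl⟩) p

/-- An injective homomorphism is isometric, so its range is a closed star subalgebra containing the
generators. -/
theorem surjective_of_injective {A B : Type*} [CStarAlgebra A] [CStarAlgebra B]
    (ρ : A →⋆ₐ[ℂ] B) (hρ : Function.Injective ρ) {S : Set B} (hS : cstarGen S = ⊤)
    (hrange : S ⊆ Set.range ρ) : Function.Surjective ρ := by
  have hcoe : (ρ.range : Set B) = Set.range ρ := Set.ext fun _ => Iff.rfl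
  have hclosed : IsClosed (ρ.range : Set B) := by
    have := (NonUnitalStarAlgHom.isometry ρ hρ).isClosedEmbedding.isClosed_range
    rwa [hcoe]
  have htop := cstarGen_eq_top_iff.1 hS ρ.range hclosed (by rwa [hcoe])
  intro b
  have hb : b ∈ ρ.range := htop ▸ trivial
  rwa [← SetLike.mem_coe, hcoe] at hb

end Family

end ToeplitzTorus

end

/-! ### The presentations for general cocycles and for `Θ`. -/

theorem mainTheorem7 (n : ℕ) :
    (∀ σ : (Fin n → ℕ) → (Fin n → ℕ) → Circle, ToeplitzTorus.IsCocycle σ →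
      -- the generators of the algebra satisfy the relations and generate it
      ToeplitzTorus.IsIsometricRep σ (ToeplitzTorus.toeplitzGen σ) ∧
      ToeplitzTorus.IsCovariant σ (ToeplitzTorus.toeplitzGen σ) ∧
      ToeplitzTorus.cstarGen (Set.range (ToeplitzTorus.toeplitzGen σ)) = ⊤ ∧
      ∀ (B : Type*) [CStarAlgebra B] (w : (Fin n → ℕ) → B),
        ToeplitzTorus.IsIsometricRep σ w →
        (ToeplitzTorus.IsCovariant σ w ↔ ToeplitzTorus.IsNicaCovariant w) ∧
        (ToeplitzTorus.IsCovariant σ w →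
          ∃ ρ : ToeplitzTorus.toeplitz σ →⋆ₐ[ℂ] B,
            (∀ p, ρ (ToeplitzTorus.toeplitzGen σ p) = w p) ∧
            (∀ ρ' : ToeplitzTorus.toeplitz σ →⋆ₐ[ℂ] B,
              (∀ p, ρ' (ToeplitzTorus.toeplitzGen σ p) = w p) → ρ' = ρ) ∧
            (Function.Injective ρ ↔
              ToeplitzTorus.defectProd (fun j => w (ToeplitzTorus.gen j)) ≠ 0))) ∧
    (∀ Θ : Matrix (Fin n) (Fin n) ℝ, Θᵀ = -Θ →
      ToeplitzTorus.IsCocycle (ToeplitzTorus.bichar Θ) ∧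
      -- the generators of the algebra satisfy the relations and generate it
      ToeplitzTorus.IsToeplitzFamily Θ
        (fun j => ToeplitzTorus.toeplitzGen (ToeplitzTorus.bichar Θ) (ToeplitzTorus.gen j)) ∧
      ToeplitzTorus.cstarGen (Set.range fun j : Fin n =>
        ToeplitzTorus.toeplitzGen (ToeplitzTorus.bichar Θ) (ToeplitzTorus.gen j)) = ⊤ ∧
      ∀ (B : Type*) [CStarAlgebra B] (w : Fin n → B),
        -- such families are the same thing as covariant isometric representations
        (ToeplitzTorus.IsToeplitzFamily Θ w ↔
          ∃! W : (Fin n → ℕ) → B,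
            ToeplitzTorus.IsIsometricRep (ToeplitzTorus.bichar Θ) W ∧
            ToeplitzTorus.IsCovariant (ToeplitzTorus.bichar Θ) W ∧
            ∀ j, W (ToeplitzTorus.gen j) = w j) ∧
        (ToeplitzTorus.IsToeplitzFamily Θ w →
          ∃ ρ : ToeplitzTorus.toeplitz (ToeplitzTorus.bichar Θ) →⋆ₐ[ℂ] B,
            (∀ j, ρ (ToeplitzTorus.toeplitzGen (ToeplitzTorus.bichar Θ)
              (ToeplitzTorus.gen j)) = w j) ∧
            (∀ ρ' : ToeplitzTorus.toeplitz (ToeplitzTorus.bichar Θ) →⋆ₐ[ℂ] B,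
              (∀ j, ρ' (ToeplitzTorus.toeplitzGen (ToeplitzTorus.bichar Θ)
                (ToeplitzTorus.gen j)) = w j) → ρ' = ρ) ∧
            (∀ p, ρ (ToeplitzTorus.toeplitzGen (ToeplitzTorus.bichar Θ) p) =
              ToeplitzTorus.orderedWord Θ w p) ∧
            (Function.Injective ρ ↔ ToeplitzTorus.defectProd w ≠ 0) ∧
            (ToeplitzTorus.cstarGen (Set.range w) = ⊤ →
              (Function.Bijective ρ ↔ ToeplitzTorus.defectProd w ≠ 0)))) := by
  refine ⟨fun σ hσ => ⟨ToeplitzTorus.isIsometricRep_toeplitzGen hσ,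
    ToeplitzTorus.isCovariant_toeplitzGen hσ, ToeplitzTorus.cstarGen_range_toeplitzGen σ,
    fun B _ w hw => ⟨hw.isCovariant_iff, fun hc => ?_⟩⟩,
    fun Θ hΘ => ⟨ToeplitzTorus.isCocycle_bichar Θ, ToeplitzTorus.isToeplitzFamily_toeplitzGen hΘ,
      ToeplitzTorus.cstarGen_range_toeplitzGen_gen Θ,
      fun B _ w => ⟨ToeplitzTorus.isToeplitzFamily_iff hΘ w, fun hw => ?_⟩⟩⟩
  · obtain ⟨ρ, hρ⟩ := ToeplitzTorus.exists_starAlgHom hσ hw hc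
    refine ⟨ρ, hρ, fun ρ' hρ' => ?_, ?_⟩
    · refine ToeplitzTorus.starAlgHom_toeplitz_ext
        (ToeplitzTorus.cstarGen_range_toeplitzGen σ) ?_
      rintro _ ⟨p, rfl⟩
      rw [hρ, hρ']
    · rw [ToeplitzTorus.injective_iff_defectProd_ne_zero]
      simp only [hρ]
  · obtain ⟨ρ, hρ⟩ := ToeplitzTorus.exists_starAlgHom (ToeplitzTorus.isCocycle_bichar Θ)
      (hw.isIsometricRep_orderedWord hΘ) (hw.isCovariant_orderedWord hΘ)
    have hgen (j : Fin n) : ρ (ToeplitzTorus.toeplitzGen (ToeplitzTorus.bichar Θ)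
        (ToeplitzTorus.gen j)) = w j := by rw [hρ, hw.orderedWord_gen hΘ]
    have hinj : Function.Injective ρ ↔ ToeplitzTorus.defectProd w ≠ 0 := by
      rw [ToeplitzTorus.injective_iff_defectProd_ne_zero]
      simp only [hgen]
    refine ⟨ρ, hgen, fun ρ' hρ' => ?_, hρ, hinj, fun hgenB => ?_⟩
    · refine ToeplitzTorus.starAlgHom_toeplitz_ext
        (ToeplitzTorus.cstarGen_range_toeplitzGen_gen Θ) ?_
      rintro _ ⟨j, rfl⟩
      rw [hgen, hρ']
    · rw [← hinj]
      refine ⟨fun hb => hb.1, fun hi => ⟨hi, ?_⟩⟩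
      refine ToeplitzTorus.surjective_of_injective ρ hi hgenB ?_
      rintro _ ⟨j, rfl⟩
      exact ⟨_, hgen j⟩
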